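/- Let $B\in\mathbb F_2^{m\times n}$ be injective as a map $\mathbb F_2^n\to\mathbb F_2^m$, so that it generates the linear code $C=\{Bx : x\in\mathbb F_2^n\}$, and let $v\in\mathbb F_2^m$. Put $f(x)=\sum_{i=1}^m(-1)^{(Bx)_i+v_i}$ for $x\in\mathbb F_2^n$. A dual decoder up to $\ell$ errors is a map $D:\mathbb F_2^n\to\mathbb F_2^m$ with $D(B^{T}e)=e$ for every $e\in\mathbb F_2^m$ of Hamming weight at most $\ell$ (a syndrome decoder of $C^\perp=\{y : B^Ty=0\}$; its running time plays no role below, so efficient decoders are included). A DQI state is a unit vector $|\psi\rangle=\sum_{x}P(f(x))\,|x\rangle$ with $P$ a complex polynomial of degree at most $\ell$. It is optimal if the expectation of $f(x)$, for $x$ obtained by measuring $|\psi\rangle$ in the computational basis, is the largest among all such states. For every real $\lambda$ with $0<\lambda<\tfrac12$ there are constants $0<c_1\le c_2<1$, depending only on $\lambda$, such that for every $\varepsilon>0$ there is an $M$ for which the following holds. For all $m\ge M$, all $n$, all $\ell$ with $\ell/m=\lambda$, every injective $B\in\mathbb F_2^{m\times n}$ that has a dual decoder up to $\ell$ errors, every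 $v\in\mathbb F_2^m$, and every optimal DQI state $|\psi\rangle$: 1. there is a set $S\subseteq\mathbb F_2^n$ of bitstrings with $|S|=2^{cn}$ for some $c\in[c_1,c_2]$ such that measuring $|\psi\rangle$ gives an outcome in $S$ with probability at least $1-\varepsilon$; 2. every set $T\subseteq\mathbb F_2^n$ with $|T|<2^{c_1n}$ contains the outcome with probability at most $\varepsilon$. So as $m\to\infty$ the optimal DQI state is concentrated on a set of bitstrings that is exponentially large and yet an exponentially small fraction of all bitstrings, and it is not concentrated on any substantially smaller set. -/

import Mathlib

namespace DQI

/-- Bitstrings of length `k`, as vectors over the field with two elements. -/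
abbrev Bits (k : ℕ) : Type := Fin k → ZMod 2

/-- The linear map `x ↦ B x` is injective, so that `{B x | x}` is a code with generating matrix `B`
and message length `n`. -/
def IsGenerator {m n : ℕ} (B : Matrix (Fin m) (Fin n) (ZMod 2)) : Prop :=
  Function.Injective fun x : Bits n => B.mulVec x

/-- `D` is a (syndrome) decoder up to `ℓ` errors for the dual code `{y | Bᵀ y = 0}`, whose parity
check matrix is `Bᵀ`: it recovers every error `e` of Hamming weight at most `ℓ` from its
syndrome `Bᵀ e`. -/
def IsDualDecoder {m n : ℕ} (B : Matrix (Fin m) (Fin n) (ZMod 2)) (ℓ : ℕ)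
    (D : Bits n → Bits m) : Prop :=
  ∀ e : Bits m, hammingNorm e ≤ ℓ → D (B.transpose.mulVec e) = e

/-- The Max-XORSAT objective `f(x) = ∑ i, (-1) ^ ((B x)_i + v_i)`: the number of equations of
`B x = v` that `x` satisfies minus the number of those that it violates. -/
def objective {m n : ℕ} (B : Matrix (Fin m) (Fin n) (ZMod 2)) (v : Bits m) (x : Bits n) : ℝ :=
  ∑ i : Fin m, (-1 : ℝ) ^ (B.mulVec x i + v i).val

/-- State vectors on `n` qubits, with the computational basis indexed by bitstrings. -/
abbrev StateVec (n : ℕ) : Type := EuclideanSpace ℂ (Bits n)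

/-- The vector `∑ x, P(f(x)) |x⟩`. -/
noncomputable def dqiVec {m n : ℕ} (B : Matrix (Fin m) (Fin n) (ZMod 2)) (v : Bits m)
    (P : Polynomial ℂ) : StateVec n :=
  WithLp.toLp 2 fun x => P.eval ((objective B v x : ℝ) : ℂ)

/-- The DQI states for `(B, v, ℓ)`: unit vectors `∑ x, P(f(x)) |x⟩` with `P` a polynomial of degree
at most `ℓ` (the normalization is absorbed in `P`). -/
def IsDQIState {m n : ℕ} (B : Matrix (Fin m) (Fin n) (ZMod 2)) (v : Bits m) (ℓ : ℕ)
    (ψ : StateVec n) : Prop :=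
  ‖ψ‖ = 1 ∧ ∃ P : Polynomial ℂ, P.natDegree ≤ ℓ ∧ ψ = dqiVec B v P

/-- The probability that measuring `ψ` in the computational basis gives an outcome in `S`. -/
noncomputable def measureProb {n : ℕ} (ψ : StateVec n) (S : Finset (Bits n)) : ℝ :=
  ∑ x ∈ S, ‖ψ x‖ ^ 2

/-- The expectation of `f(x)` when `x` is the outcome of measuring `ψ`. -/
noncomputable def expectedObjective {m n : ℕ} (B : Matrix (Fin m) (Fin n) (ZMod 2)) (v : Bits m)
    (ψ : StateVec n) : ℝ :=
  ∑ x : Bits n, ‖ψ x‖ ^ 2 * objective B v x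

/-- `ψ` is an optimal DQI state: its expected objective is the largest among all DQI states with
polynomials of degree at most `ℓ`. -/
def IsOptimalDQIState {m n : ℕ} (B : Matrix (Fin m) (Fin n) (ZMod 2)) (v : Bits m) (ℓ : ℕ)
    (ψ : StateVec n) : Prop :=
  IsDQIState B v ℓ ψ ∧
    ∀ φ : StateVec n, IsDQIState B v ℓ φ → expectedObjective B v φ ≤ expectedObjective B v ψ

end DQI

/-!
Write `χ_S(x) = ∏_{i ∈ S} (-1) ^ ((B x)_i + v_i)`. Translating `x` shows that `χ_S` and `χ_T` are
orthogonal unless `S` and `T` have the same syndrome `Bᵀ 1_S = Bᵀ 1_T`, and a dual decoder up to `ℓ`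
errors forces distinct sets with equal syndromes to differ in more than `2 ℓ` places
(`IsDualDecoder.dualDistGT`). So the normalized elementary symmetric polynomials `kVec B v k`,
`k ≤ ℓ`, of the signs are orthonormal, the DQI states are their unit combinations, and by the
Krawtchouk recurrence the objective `f` acts on them as the Jacobi matrix with zero diagonal and
off-diagonal entries `b k = √(k (m - k + 1))` (`isJacobiChain_kVec`). There is one correction:
`f * kVec B v ℓ` has a part of degree `ℓ + 1`, which can correlate with `kVec B v ℓ` through the dual
codewords of weight `2 ℓ + 1` and adds a corner entry to the matrix.

Both the corner entry and the size of small sets are controlled by a Johnson bound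
(`card_cosetWords_le`): a coset of the dual code has at most `2 / λ` words of weight `ℓ + r` as long
as `r ≤ λ² m / 2`, where `ℓ = λ m`. With `r = 2` it makes the corner entry bounded
(`re_inner_kVec_boundaryVec_mul_le`). With `r` proportional to `m` it makes `2 ^ n`, the number of
syndromes, exponentially larger than `m.choose ℓ`.

*Small sets are unlikely.* The amplitudes of a normalized combination of the `kVec B v k` satisfy
`|ψ x|² ≤ (ℓ + 1) (m.choose ℓ) / 2 ^ n`, so every outcome is exponentially unlikely
(`measureProb_mul_pow_le`).

*The objective is large.* The coefficients `p` that are constant on a long window just below `ℓ`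
give an expectation of nearly `2 b ℓ`. As the Jacobi matrix has norm at most `2 b ℓ`, with a loss
`b ℓ |p ℓ|²` coming from the last coefficient, the last coefficient of an optimal state tends to
zero. Then `‖f ψ‖` is not much larger than `2 b ℓ` either, so the variance of `f` is `o(m²)`, and
`f ≥ b ℓ ≥ λ m` with probability near one (`measureProb_objective_lt_le`).

*Large objectives are rare.* Applying the Jacobi matrix `k ≤ ℓ` times to the constant function bounds
the moment of order `2 k` of `f` under the uniform distribution by `(2 b k) ^ (2 k)`. For `k` a small
multiple of `m`, Markov's inequality shows that `f ≥ λ m` holds for an exponentially small fraction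
of the bitstrings (`card_le_objective_mul_two_pow_le`).
-/

namespace DQI

open Finset

/-! ### Signs, characters and the Krawtchouk recurrence -/

section

/-- The sign `(-1) ^ a` of a bit `a`, as a real number. -/
noncomputable def bitSign (a : ZMod 2) : ℝ := (-1 : ℝ) ^ a.val

lemma bitSign_zero : bitSign 0 = 1 := by simp [bitSign]

lemma bitSign_add (a b : ZMod 2) : bitSign (a + b) = bitSign a * bitSign b := by
  revert a b
  have h : ∀ a : ZMod 2, a = 0 ∨ a = 1 := by decide
  have h1 : ((1 : ZMod 2) + 1) = 0 := by decide
  have hv : (1 : ZMod 2).val = 1 := by decide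
  intro a b
  rcases h a with rfl | rfl <;> rcases h b with rfl | rfl <;> simp [bitSign, h1, hv]

lemma bitSign_mul_self (a : ZMod 2) : bitSign a * bitSign a = 1 := by
  rw [← bitSign_add, CharTwo.add_self_eq_zero, bitSign_zero]

lemma bitSign_ne_zero {a : ZMod 2} (h : a ≠ 0) : bitSign a = -1 := by
  have h' : ∀ a : ZMod 2, a ≠ 0 → a = 1 := by decide
  have hv : (1 : ZMod 2).val = 1 := by decide
  simp [bitSign, h' a h, hv]

lemma bitSign_sum {ι : Type*} (s : Finset ι) (g : ι → ZMod 2) :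
    bitSign (∑ i ∈ s, g i) = ∏ i ∈ s, bitSign (g i) := by
  classical
  induction s using Finset.induction_on with
  | empty => simp [bitSign_zero]
  | insert a s ha ih => rw [sum_insert ha, prod_insert ha, bitSign_add, ih]

variable {m n : ℕ}

/-- The product over `i ∈ S` of the signs `(-1) ^ ((B x)_i + v_i)`. -/
noncomputable def chi (B : Matrix (Fin m) (Fin n) (ZMod 2)) (v : Bits m) (S : Finset (Fin m))
    (x : Bits n) : ℝ :=
  ∏ i ∈ S, bitSign (B.mulVec x i + v i)

/-- The syndrome `Bᵀ 1_S` of the indicator vector of `S`. -/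
def syndrome (B : Matrix (Fin m) (Fin n) (ZMod 2)) (S : Finset (Fin m)) : Bits n :=
  fun j => ∑ i ∈ S, B i j

/-- The `k`-th elementary symmetric polynomial of the signs `(-1) ^ ((B x)_i + v_i)`. -/
noncomputable def esymm (B : Matrix (Fin m) (Fin n) (ZMod 2)) (v : Bits m) (k : ℕ)
    (x : Bits n) : ℝ :=
  ∑ S ∈ powersetCard k univ, chi B v S x

variable (B : Matrix (Fin m) (Fin n) (ZMod 2)) (v : Bits m)

lemma objective_eq_sum_bitSign (x : Bits n) :
    objective B v x = ∑ i, bitSign (B.mulVec x i + v i) := rfl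

lemma chi_mul_self (S : Finset (Fin m)) (x : Bits n) : chi B v S x * chi B v S x = 1 := by
  rw [chi, ← prod_mul_distrib]
  exact prod_eq_one fun i _ => bitSign_mul_self _

lemma abs_chi (S : Finset (Fin m)) (x : Bits n) : |chi B v S x| = 1 := by
  have h := chi_mul_self B v S x
  rw [← abs_mul_abs_self] at h
  nlinarith [abs_nonneg (chi B v S x)]

lemma abs_bitSign (a : ZMod 2) : |bitSign a| = 1 := by
  simp [bitSign, abs_pow]

lemma abs_objective_le (x : Bits n) : |objective B v x| ≤ m := by
  rw [objective_eq_sum_bitSign]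
  refine (abs_sum_le_sum_abs _ _).trans ?_
  simp [abs_bitSign]

lemma abs_esymm_le (k : ℕ) (x : Bits n) : |esymm B v k x| ≤ m.choose k := by
  refine (abs_sum_le_sum_abs _ _).trans ?_
  simp [abs_chi]

lemma esymm_zero (x : Bits n) : esymm B v 0 x = 1 := by
  simp [esymm, chi]

lemma chi_add_single (S : Finset (Fin m)) (x : Bits n) (j : Fin n) :
    chi B v S (x + Pi.single j 1) = bitSign (syndrome B S j) * chi B v S x := by
  rw [syndrome, bitSign_sum, chi, chi, ← prod_mul_distrib]
  refine prod_congr rfl fun i _ => ?_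
  rw [← bitSign_add, Matrix.mulVec_add, Matrix.mulVec_single_one]
  congr 1
  simp only [Pi.add_apply, Matrix.col_apply]
  ring

/-- Characters with different syndromes are orthogonal: translating `x` by a unit vector on which
the syndromes differ flips the sign of the product. -/
lemma sum_chi_mul_chi_of_ne {S T : Finset (Fin m)} (h : syndrome B S ≠ syndrome B T) :
    ∑ x, chi B v S x * chi B v T x = 0 := by
  obtain ⟨j, hj⟩ := Function.ne_iff.mp h
  have hs : bitSign (syndrome B S j) * bitSign (syndrome B T j) = -1 := by
    rw [← bitSign_add]
    exact bitSign_ne_zero fun h0 => hj (CharTwo.add_eq_zero.mp h0)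
  have hshift := Equiv.sum_comp (Equiv.addRight (Pi.single j 1 : Bits n))
    (fun x => chi B v S x * chi B v T x)
  simp only [Equiv.coe_addRight, chi_add_single] at hshift
  have : ∀ x, bitSign (syndrome B S j) * chi B v S x * (bitSign (syndrome B T j) * chi B v T x)
      = -(chi B v S x * chi B v T x) := fun x => by
    linear_combination (chi B v S x * chi B v T x) * hs
  simp only [this, sum_neg_distrib] at hshift
  linarith

lemma sum_chi_mul_self (S : Finset (Fin m)) :
    ∑ x, chi B v S x * chi B v S x = 2 ^ n := by
  simp [chi_mul_self]

lemma sum_chi_mul_chi_le (S T : Finset (Fin m)) :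
    ∑ x, chi B v S x * chi B v T x ≤ 2 ^ n := by
  calc ∑ x, chi B v S x * chi B v T x ≤ ∑ _x : Bits n, (1 : ℝ) := by
        refine sum_le_sum fun x _ => (le_abs_self _).trans ?_
        simp [abs_mul, abs_chi]
    _ = 2 ^ n := by simp

lemma sum_powersetCard_succ_erase {α M : Type*} [Fintype α] [DecidableEq α] [AddCommMonoid M]
    (k : ℕ) (g : Finset α → α → M) :
    ∑ S ∈ powersetCard (k + 1) univ, ∑ i ∈ S, g (S.erase i) i =
      ∑ S ∈ powersetCard k univ, ∑ i ∈ Sᶜ, g S i := by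
  rw [sum_sigma', sum_sigma']
  refine sum_bij' (fun a _ => ⟨a.1.erase a.2, a.2⟩) (fun a _ => ⟨insert a.2 a.1, a.2⟩) ?_ ?_ ?_ ?_ ?_
  · rintro ⟨S, i⟩ h
    simp only [mem_sigma, mem_powersetCard_univ, mem_compl] at h ⊢
    exact ⟨by rw [card_erase_of_mem h.2, h.1]; simp, by simp⟩
  · rintro ⟨S, i⟩ h
    simp only [mem_sigma, mem_powersetCard_univ, mem_compl] at h ⊢
    exact ⟨by rw [card_insert_of_notMem h.2, h.1], by simp⟩
  · rintro ⟨S, i⟩ h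
    simp only [mem_sigma] at h
    simp [insert_erase h.2]
  · rintro ⟨S, i⟩ h
    simp only [mem_sigma, mem_compl] at h
    simp [erase_insert h.2]
  · rintro ⟨S, i⟩ h
    rfl

lemma chi_insert {S : Finset (Fin m)} {i : Fin m} (h : i ∉ S) (x : Bits n) :
    chi B v (insert i S) x = bitSign (B.mulVec x i + v i) * chi B v S x := by
  rw [chi, prod_insert h, chi]

lemma bitSign_mul_chi {S : Finset (Fin m)} {i : Fin m} (h : i ∈ S) (x : Bits n) :
    bitSign (B.mulVec x i + v i) * chi B v S x = chi B v (S.erase i) x := by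
  conv_lhs => rw [← insert_erase h, chi_insert B v (notMem_erase i S)]
  rw [← mul_assoc, bitSign_mul_self, one_mul]

lemma sum_insert_chi (k : ℕ) (x : Bits n) :
    ∑ S ∈ powersetCard k univ, ∑ i ∈ Sᶜ, chi B v (insert i S) x = (k + 1) * esymm B v (k + 1) x := by
  rw [← sum_powersetCard_succ_erase k (fun S i => chi B v (insert i S) x), esymm, mul_sum]
  refine sum_congr rfl fun S hS => ?_
  rw [mem_powersetCard_univ] at hS
  rw [sum_congr rfl fun i hi => by rw [insert_erase hi]]
  simp [hS]

lemma sum_erase_chi (k : ℕ) (x : Bits n) :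
    ∑ S ∈ powersetCard (k + 1) univ, ∑ i ∈ S, chi B v (S.erase i) x
      = (m - k) * esymm B v k x := by
  rw [sum_powersetCard_succ_erase k (fun S _ => chi B v S x), esymm, mul_sum]
  refine sum_congr rfl fun S hS => ?_
  rw [mem_powersetCard_univ] at hS
  have : k ≤ m := by simpa [hS] using card_le_univ S
  simp [card_compl, hS, Nat.cast_sub this]

/-- The three-term recurrence of the (binary) Krawtchouk polynomials. -/
lemma objective_mul_esymm_succ (k : ℕ) (x : Bits n) :
    objective B v x * esymm B v (k + 1) x =
      (k + 2) * esymm B v (k + 2) x + (m - k) * esymm B v k x := by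
  have h2 := sum_insert_chi B v (k + 1) x
  rw [← sum_erase_chi, show ((k : ℝ) + 2) = ((k + 1 : ℕ) : ℝ) + 1 by push_cast; ring, ← h2,
    ← sum_add_distrib, esymm, mul_sum]
  refine sum_congr rfl fun S _ => ?_
  rw [objective_eq_sum_bitSign, sum_mul, ← sum_add_sum_compl S, add_comm]
  congr 1
  · exact sum_congr rfl fun i hi => (chi_insert B v (mem_compl.mp hi) x).symm
  · exact sum_congr rfl fun i hi => bitSign_mul_chi B v hi x

lemma objective_mul_esymm_zero (x : Bits n) :
    objective B v x * esymm B v 0 x = esymm B v 1 x := by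
  rw [esymm_zero, mul_one, objective_eq_sum_bitSign, esymm, powersetCard_one, sum_map]
  simp [chi]

/-- The dual code has minimum distance greater than `2 * ℓ`: two sets with equal syndromes are
equal or far apart. -/
def DualDistGT (B : Matrix (Fin m) (Fin n) (ZMod 2)) (ℓ : ℕ) : Prop :=
  ∀ S T : Finset (Fin m), syndrome B S = syndrome B T → S ≠ T → 2 * ℓ < #(symmDiff S T)

variable {B}

lemma sum_esymm_mul_esymm {ℓ : ℕ} (hB : DualDistGT B ℓ) {j k : ℕ} (hjk : j + k ≤ 2 * ℓ) :
    ∑ x, esymm B v j x * esymm B v k x = if j = k then 2 ^ n * (m.choose k : ℝ) else 0 := by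
  have key : ∀ S ∈ powersetCard j (univ : Finset (Fin m)),
      ∀ T ∈ powersetCard k (univ : Finset (Fin m)),
      ∑ x, chi B v S x * chi B v T x = if S = T then 2 ^ n else 0 := by
    intro S hS T hT
    rw [mem_powersetCard_univ] at hS hT
    split_ifs with h
    · rw [h, sum_chi_mul_self]
    · refine sum_chi_mul_chi_of_ne B v fun hs => ?_
      have h1 := hB S T hs h
      have h2 : #(symmDiff S T) ≤ #S + #T := by
        rw [symmDiff_def]
        refine (card_union_le _ _).trans (add_le_add (card_le_card sdiff_subset)
          (card_le_card sdiff_subset))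
      omega
  simp only [esymm, sum_mul_sum]
  rw [sum_comm]
  simp_rw [sum_comm (s := univ)]
  rw [sum_congr rfl fun S hS => sum_congr rfl fun T hT => key S hS T hT]
  simp only [sum_ite_eq, mem_powersetCard_univ]
  split_ifs with h
  · subst h
    rw [sum_congr rfl fun S hS => if_pos (mem_powersetCard_univ.mp hS)]
    simp [mul_comm]
  · refine sum_eq_zero fun S hS => if_neg fun h' => h ?_
    rw [← mem_powersetCard_univ.mp hS, h']

end

/-! ### Counting words in cosets of the dual code -/

section

variable {m n : ℕ} {B : Matrix (Fin m) (Fin n) (ZMod 2)}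

lemma bits_add_eq_zero {k : ℕ} {a b : Bits k} : a + b = 0 ↔ a = b := by
  simp only [funext_iff, Pi.add_apply, Pi.zero_apply, CharTwo.add_eq_zero]

lemma syndrome_disjUnion {S T : Finset (Fin m)} (h : Disjoint S T) :
    syndrome B (S ∪ T) = syndrome B S + syndrome B T := by
  funext j
  exact sum_union h

lemma transpose_mulVec_indicator (S : Finset (Fin m)) :
    B.transpose.mulVec (fun i => if i ∈ S then 1 else 0) = syndrome B S := by
  funext j
  simp [Matrix.mulVec, dotProduct, syndrome]

lemma IsDualDecoder.injOn_syndrome {ℓ : ℕ} {D : Bits n → Bits m} (hD : IsDualDecoder B ℓ D)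
    {S T : Finset (Fin m)} (hS : #S ≤ ℓ) (hT : #T ≤ ℓ) (h : syndrome B S = syndrome B T) :
    S = T := by
  have key : ∀ S : Finset (Fin m), #S ≤ ℓ →
      D (syndrome B S) = fun i => if i ∈ S then 1 else 0 := fun S hS => by
    rw [← transpose_mulVec_indicator]
    exact hD _ (by simpa [hammingNorm] using hS)
  have h1 := (key S hS).symm.trans ((congrArg D h).trans (key T hT))
  ext i
  have h2 := congrFun h1 i
  by_cases hi : i ∈ S <;> by_cases hi' : i ∈ T <;> simp_all

/-- A low-weight dual codeword splits into two halves of weight at most `ℓ` with equal syndromes,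
which a decoder cannot distinguish. -/
lemma IsDualDecoder.dualDistGT {ℓ : ℕ} {D : Bits n → Bits m} (hD : IsDualDecoder B ℓ D) :
    DualDistGT B ℓ := by
  intro S T hST hne
  by_contra! hcard
  have hS : syndrome B S = syndrome B (S \ T) + syndrome B (S ∩ T) := by
    rw [← syndrome_disjUnion (disjoint_sdiff_inter S T), sdiff_union_inter]
  have hT : syndrome B T = syndrome B (T \ S) + syndrome B (S ∩ T) := by
    rw [inter_comm, ← syndrome_disjUnion (disjoint_sdiff_inter T S), sdiff_union_inter]
  have h0 : syndrome B (symmDiff S T) = 0 := by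
    rw [symmDiff_def, sup_eq_union, syndrome_disjUnion disjoint_sdiff_sdiff,
      add_right_cancel (hS.symm.trans (hST.trans hT)), bits_add_eq_zero]
  obtain ⟨U, hU, hUc⟩ := exists_subset_card_eq (min_le_right ℓ #(symmDiff S T))
  have hV : syndrome B U = syndrome B (symmDiff S T \ U) := by
    rw [← bits_add_eq_zero, ← syndrome_disjUnion disjoint_sdiff, union_sdiff_of_subset hU, h0]
  have hVc := card_sdiff_of_subset hU
  have hUV := hD.injOn_syndrome (by omega) (by omega) hV
  have hUe : U = ∅ := by
    have := disjoint_sdiff (s := U) (t := symmDiff S T)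
    rwa [← hUV, disjoint_self_iff_empty] at this
  have hempty : symmDiff S T = ∅ := by
    rw [← sdiff_empty (s := symmDiff S T), ← hUe, ← hUV, hUe]
  exact hne (symmDiff_eq_bot.mp hempty)

/-- The Johnson bound, by double counting the pairs of members that share a point. -/
lemma card_mul_sq_le_of_card_inter_le {α : Type*} [Fintype α] [DecidableEq α]
    (F : Finset (Finset α)) (w t : ℝ) (htw : t ≤ w) (hw : ∀ S ∈ F, (#S : ℝ) = w)
    (ht : ∀ S ∈ F, ∀ T ∈ F, S ≠ T → (#(S ∩ T) : ℝ) ≤ t) :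
    (#F : ℝ) * w ^ 2 ≤ Fintype.card α * (w - t + #F * t) := by
  rcases F.eq_empty_or_nonempty with rfl | hne
  · simp only [card_empty, Nat.cast_zero, zero_mul, add_zero]
    exact mul_nonneg (Nat.cast_nonneg _) (sub_nonneg.mpr htw)
  have hpos : (0 : ℝ) < #F := by exact_mod_cast hne.card_pos
  have hsum : ∑ i, ∑ S ∈ F, (if i ∈ S then (1 : ℝ) else 0) = #F * w := by
    rw [sum_comm]
    simp only [sum_ite_mem, univ_inter, sum_const, nsmul_eq_mul, mul_one]
    rw [sum_congr rfl hw]; simp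
  have hsq : ∑ i, (∑ S ∈ F, (if i ∈ S then (1 : ℝ) else 0)) ^ 2 = ∑ S ∈ F, ∑ T ∈ F, (#(S ∩ T) : ℝ) := by
    simp_rw [sq, sum_mul_sum]
    rw [sum_comm]
    refine sum_congr rfl fun S _ => ?_
    rw [sum_comm]
    refine sum_congr rfl fun T _ => ?_
    simp only [← ite_and, mul_ite, mul_one, mul_zero]
    rw [← sum_filter]
    simp only [sum_const, nsmul_eq_mul, mul_one]
    congr 2
    ext i; simp [and_comm]
  have hle : ∑ S ∈ F, ∑ T ∈ F, (#(S ∩ T) : ℝ) ≤ #F * (w - t + #F * t) := by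
    calc ∑ S ∈ F, ∑ T ∈ F, (#(S ∩ T) : ℝ)
        ≤ ∑ S ∈ F, ∑ T ∈ F, ((if S = T then w - t else 0) + t) := by
          refine sum_le_sum fun S hS => sum_le_sum fun T hT => ?_
          split_ifs with h
          · subst h; simp [hw S hS]
          · simpa using ht S hS T hT h
      _ = #F * (w - t + #F * t) := by
          rw [sum_congr rfl fun S hS => by
            rw [sum_add_distrib, sum_ite_eq, if_pos hS]]
          simp [mul_add]
  have hcs := sq_sum_le_card_mul_sum_sq (s := (univ : Finset α))
    (f := fun i => ∑ S ∈ F, (if i ∈ S then (1 : ℝ) else 0))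
  rw [hsum, hsq, card_univ] at hcs
  have : (#F : ℝ) * (#F * w ^ 2) ≤ #F * (Fintype.card α * (w - t + #F * t)) := by
    nlinarith [mul_le_mul_of_nonneg_left hle (Nat.cast_nonneg (α := ℝ) (Fintype.card α))]
  exact le_of_mul_le_mul_left this hpos

/-- The words of weight `w` with syndrome `s`: the weight-`w` part of a coset of the dual code. -/
def cosetWords (B : Matrix (Fin m) (Fin n) (ZMod 2)) (w : ℕ) (s : Bits n) :
    Finset (Finset (Fin m)) :=
  {S ∈ powersetCard w univ | syndrome B S = s}

lemma card_symmDiff_add {α : Type*} [DecidableEq α] (S T : Finset α) :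
    #(symmDiff S T) + 2 * #(S ∩ T) = #S + #T := by
  have h1 := card_sdiff_add_card_inter S T
  have h2 := card_sdiff_add_card_inter T S
  rw [inter_comm] at h2
  rw [symmDiff_def, sup_eq_union, card_union_of_disjoint disjoint_sdiff_sdiff]
  omega

/-- List decoding beyond half the distance: slightly above the unique decoding radius `ℓ`, a coset
of the dual code still has boundedly many words of a given weight. -/
lemma card_cosetWords_le {ℓ r : ℕ} (hB : DualDistGT B ℓ) {lam : ℝ} (hlam : 0 < lam) (hm : 0 < m)
    (hℓ : (ℓ : ℝ) = lam * m) (hr : (r : ℝ) ≤ lam ^ 2 * m / 2) (s : Bits n) :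
    (#(cosetWords B (ℓ + r) s) : ℝ) ≤ 2 / lam := by
  have hm' : (0 : ℝ) < m := by exact_mod_cast hm
  have h := card_mul_sq_le_of_card_inter_le (cosetWords B (ℓ + r) s) ((ℓ : ℝ) + r) r
    (by linarith [(Nat.cast_nonneg ℓ : (0 : ℝ) ≤ ℓ)])
    (fun S hS => by
      simp only [cosetWords, mem_filter, mem_powersetCard_univ] at hS
      rw [hS.1]; push_cast; rfl)
    (fun S hS T hT hne => by
      simp only [cosetWords, mem_filter, mem_powersetCard_univ] at hS hT
      have h1 := hB S T (hS.2.trans hT.2.symm) hne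
      have h2 := card_symmDiff_add S T
      have : #(S ∩ T) ≤ r := by omega
      exact_mod_cast this)
  rw [Fintype.card_fin, hℓ] at h
  set N : ℝ := (#(cosetWords B (ℓ + r) s) : ℝ)
  have hN : 0 ≤ N := Nat.cast_nonneg _
  have hr0 : (0 : ℝ) ≤ r := Nat.cast_nonneg _
  rw [le_div_iff₀ hlam]
  have h1 : N * (lam * m) ^ 2 ≤ N * (lam * m + r) ^ 2 := by gcongr; linarith
  have h2 : m * N * r ≤ m * N * (lam ^ 2 * m / 2) := by gcongr
  have h3 : (lam * m ^ 2) * (N * lam) ≤ (lam * m ^ 2) * 2 := by nlinarith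
  exact le_of_mul_le_mul_left h3 (by positivity)

lemma choose_le_of_card_cosetWords_le {w : ℕ} {N : ℝ}
    (h : ∀ s, (#(cosetWords B w s) : ℝ) ≤ N) : (m.choose w : ℝ) ≤ N * 2 ^ n := by
  have h1 := card_eq_sum_card_fiberwise (s := powersetCard w (univ : Finset (Fin m)))
    (t := (univ : Finset (Bits n))) (f := syndrome B) (fun _ _ => by simp)
  rw [card_powersetCard, card_univ, Fintype.card_fin] at h1
  rw [h1]
  push_cast
  calc ∑ s, (#{S ∈ powersetCard w (univ : Finset (Fin m)) | syndrome B S = s} : ℝ)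
      ≤ ∑ _s : Bits n, N := sum_le_sum fun s _ => h s
    _ = N * 2 ^ n := by simp [mul_comm]

/-- The pairs of a set of size `ℓ` and a set of size `ℓ + 1` that have the same syndrome. They come
from the dual codewords of weight `2 * ℓ + 1`. -/
def boundaryPairs (B : Matrix (Fin m) (Fin n) (ZMod 2)) (ℓ : ℕ) :
    Finset (Finset (Fin m) × Finset (Fin m)) :=
  {p ∈ powersetCard ℓ univ ×ˢ powersetCard (ℓ + 1) univ | syndrome B p.1 = syndrome B p.2}

lemma syndrome_insert {S : Finset (Fin m)} {i : Fin m} (h : i ∉ S) :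
    syndrome B (insert i S) = B i + syndrome B S := by
  funext j
  exact sum_insert h

/-- A pair in `boundaryPairs B ℓ` can be enlarged by any common new point, and remembers it as the
only common point; so boundedness of the cosets at weight `ℓ + 2` makes such pairs rare. -/
lemma card_boundaryPairs_mul_le {ℓ : ℕ} (hB : DualDistGT B ℓ) {N : ℝ}
    (h : ∀ s, (#(cosetWords B (ℓ + 2) s) : ℝ) ≤ N) :
    (#(boundaryPairs B ℓ) : ℝ) * (m - 2 * ℓ - 1) ≤ N * m.choose (ℓ + 1) := by
  have hdisj : ∀ p ∈ boundaryPairs B ℓ, Disjoint p.1 p.2 ∧ #p.1 = ℓ ∧ #p.2 = ℓ + 1 ∧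
      syndrome B p.1 = syndrome B p.2 := by
    rintro ⟨S, T⟩ hp
    simp only [boundaryPairs, mem_filter, mem_product, mem_powersetCard_univ] at hp ⊢
    obtain ⟨⟨hS, hT⟩, hs⟩ := hp
    have h1 := hB S T hs (fun h => by rw [h] at hS; omega)
    have h2 := card_symmDiff_add S T
    refine ⟨?_, hS, hT, hs⟩
    rw [disjoint_iff_inter_eq_empty, ← card_eq_zero]
    omega
  have hle : #((boundaryPairs B ℓ).sigma fun p => (p.1 ∪ p.2)ᶜ) ≤
      #((powersetCard (ℓ + 1) (univ : Finset (Fin m))).sigma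
        fun Y => cosetWords B (ℓ + 2) (syndrome B Y)) := by
    refine card_le_card_of_injOn (fun a => ⟨insert a.2 a.1.1, insert a.2 a.1.2⟩) ?_ ?_
    · rintro ⟨⟨S, T⟩, j⟩ ha
      simp only [coe_sigma, Set.mem_sigma_iff, mem_coe, mem_compl, mem_union, not_or] at ha
      obtain ⟨hp, hjS, hjT⟩ := ha
      obtain ⟨-, hS, hT, hs⟩ := hdisj _ hp
      simp only at hS hT hs
      simp only [coe_sigma, Set.mem_sigma_iff, mem_coe, cosetWords, mem_filter,
        mem_powersetCard_univ, card_insert_of_notMem hjS, card_insert_of_notMem hjT,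
        syndrome_insert hjS, syndrome_insert hjT, hS, hT, hs, and_self]
    · rintro ⟨⟨S, T⟩, j⟩ ha ⟨⟨S', T'⟩, j'⟩ ha' heq
      simp only [coe_sigma, Set.mem_sigma_iff, mem_coe, mem_compl, mem_union, not_or] at ha ha'
      obtain ⟨hp, hjS, hjT⟩ := ha
      obtain ⟨hp', hjS', hjT'⟩ := ha'
      simp only [Sigma.mk.injEq, heq_eq_eq] at heq
      have key : ∀ (S T : Finset (Fin m)) (j : Fin m), Disjoint S T →
          insert j S ∩ insert j T = {j} := fun S T j hd => by
        rw [← insert_inter_distrib, disjoint_iff_inter_eq_empty.mp hd]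
        rfl
      have hj : ({j} : Finset (Fin m)) = {j'} := by
        rw [← key S T j (hdisj _ hp).1, ← key S' T' j' (hdisj _ hp').1, heq.1, heq.2]
      obtain rfl := singleton_injective hj
      have hS : S = S' := by
        rw [← erase_insert hjS, heq.1, erase_insert hjS']
      have hT : T = T' := by
        rw [← erase_insert hjT, heq.2, erase_insert hjT']
      rw [hS, hT]
  rw [card_sigma, card_sigma] at hle
  have hle' : (∑ p ∈ boundaryPairs B ℓ, (#((p.1 ∪ p.2)ᶜ) : ℝ)) ≤
      ∑ Y ∈ powersetCard (ℓ + 1) (univ : Finset (Fin m)),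
        (#(cosetWords B (ℓ + 2) (syndrome B Y)) : ℝ) := by exact_mod_cast hle
  have hleft : (∑ p ∈ boundaryPairs B ℓ, (#((p.1 ∪ p.2)ᶜ) : ℝ)) =
      (#(boundaryPairs B ℓ) : ℝ) * (m - 2 * ℓ - 1) := by
    rw [sum_congr rfl fun p hp => ?_, sum_const, nsmul_eq_mul]
    obtain ⟨hd, hS, hT, -⟩ := hdisj p hp
    have h1 := card_add_card_compl (p.1 ∪ p.2)
    rw [card_union_of_disjoint hd, hS, hT, Fintype.card_fin] at h1
    have h2 : ((ℓ : ℝ) + (ℓ + 1)) + #((p.1 ∪ p.2)ᶜ) = m := by exact_mod_cast h1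
    linarith
  rw [← hleft]
  refine hle'.trans ?_
  calc _ ≤ ∑ _Y ∈ powersetCard (ℓ + 1) (univ : Finset (Fin m)), N := sum_le_sum fun Y _ => h _
    _ = N * m.choose (ℓ + 1) := by simp [mul_comm]

lemma sum_esymm_mul_esymm_succ_le (v : Bits m) (ℓ : ℕ) :
    ∑ x, esymm B v ℓ x * esymm B v (ℓ + 1) x ≤ 2 ^ n * #(boundaryPairs B ℓ) := by
  have key : ∀ S T : Finset (Fin m), ∑ x, chi B v S x * chi B v T x ≤
      if syndrome B S = syndrome B T then 2 ^ n else 0 := by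
    intro S T
    split_ifs with h
    · exact sum_chi_mul_chi_le B v S T
    · exact (sum_chi_mul_chi_of_ne B v h).le
  simp only [esymm, sum_mul_sum]
  rw [sum_comm]
  simp_rw [sum_comm (s := univ)]
  refine (sum_le_sum fun S _ => sum_le_sum fun T _ => key S T).trans ?_
  rw [← sum_product', ← sum_filter, boundaryPairs]
  simp [mul_comm]

end

/-! ### Finite sections of a Jacobi matrix -/

section

section Jacobi

variable {E : Type*} [NormedAddCommGroup E] [InnerProductSpace ℂ E]

/-- The operator `M` acts on the orthonormal vectors `K 0, …, K ℓ` as the tridiagonal matrix with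
zero diagonal and off-diagonal entries `b 1, …, b ℓ`, except that `M (K ℓ)` has a further component
`W`, which is orthogonal to all these vectors but possibly `K ℓ`. The condition `b 0 = 0` makes the
value of `K (k - 1)` at `k = 0` irrelevant. -/
structure IsJacobiChain (M : E →ₗ[ℂ] E) (K : ℕ → E) (b : ℕ → ℝ) (ℓ : ℕ) (W : E) : Prop where
  inner_eq : ∀ j ≤ ℓ, ∀ k ≤ ℓ, inner ℂ (K j) (K k) = if j = k then (1 : ℂ) else 0
  b_zero : b 0 = 0
  b_mono : ∀ j k, j ≤ k → k ≤ ℓ → b j ≤ b k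
  map_eq : ∀ k < ℓ, M (K k) = (b k : ℂ) • K (k - 1) + (b (k + 1) : ℂ) • K (k + 1)
  map_last : M (K ℓ) = (b ℓ : ℂ) • K (ℓ - 1) + W
  inner_W : ∀ j < ℓ, inner ℂ (K j) W = 0

/-- The linear combination of `K 0, …, K ℓ` with coefficients `p`. -/
def comb (K : ℕ → E) (ℓ : ℕ) (p : ℕ → ℂ) : E := ∑ k ∈ range (ℓ + 1), p k • K k

/-- The tridiagonal matrix with zero diagonal and off-diagonal entries `b`, applied to `p`. -/
def jacobi (b : ℕ → ℝ) (p : ℕ → ℂ) (k : ℕ) : ℂ := b k * p (k - 1) + b (k + 1) * p (k + 1)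

lemma sum_smul_comb {ι : Type*} (s : Finset ι) (K : ℕ → E) (ℓ : ℕ) (c : ι → ℂ) (p : ι → ℕ → ℂ) :
    ∑ i ∈ s, c i • comb K ℓ (p i) = comb K ℓ (fun k => ∑ i ∈ s, c i * p i k) := by
  simp only [comb, smul_sum, sum_smul, smul_smul]
  exact sum_comm

lemma comb_single (K : ℕ → E) {ℓ k : ℕ} (h : k ≤ ℓ) :
    comb K ℓ (fun j => if j = k then 1 else 0) = K k := by
  simp [comb, ite_smul, Nat.lt_succ_iff.mpr h]

/-- The trial vector that is constant on a window of length `R` just below `ℓ`. -/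
noncomputable def windowCoeff (ℓ R : ℕ) (k : ℕ) : ℂ :=
  if ℓ - R ≤ k ∧ k < ℓ then (((√R)⁻¹ : ℝ) : ℂ) else 0

variable {M : E →ₗ[ℂ] E} {K : ℕ → E} {b : ℕ → ℝ} {ℓ : ℕ} {W : E}

namespace IsJacobiChain

lemma b_nonneg (h : IsJacobiChain M K b ℓ W) {k : ℕ} (hk : k ≤ ℓ) : 0 ≤ b k :=
  h.b_zero.symm.trans_le (h.b_mono 0 k (Nat.zero_le k) hk)

lemma inner_comb (h : IsJacobiChain M K b ℓ W) (p q : ℕ → ℂ) :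
    inner ℂ (comb K ℓ p) (comb K ℓ q) = ∑ k ∈ range (ℓ + 1), star (p k) * q k := by
  simp only [comb, sum_inner, inner_sum, inner_smul_left, inner_smul_right]
  refine sum_congr rfl fun k hk => ?_
  have hk' := mem_range_succ_iff.mp hk
  rw [sum_congr rfl fun j hj => by
    rw [h.inner_eq j (mem_range_succ_iff.mp hj) k hk']]
  simp [Nat.lt_succ_iff.mpr hk', mul_comm]

lemma norm_sq_comb (h : IsJacobiChain M K b ℓ W) (p : ℕ → ℂ) :
    ‖comb K ℓ p‖ ^ 2 = ∑ k ∈ range (ℓ + 1), ‖p k‖ ^ 2 := by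
  have h1 := inner_self_eq_norm_sq (𝕜 := ℂ) (comb K ℓ p)
  have h2 : ∑ k ∈ range (ℓ + 1), star (p k) * p k = ((∑ k ∈ range (ℓ + 1), ‖p k‖ ^ 2 : ℝ) : ℂ) := by
    push_cast
    exact sum_congr rfl fun k _ => Complex.conj_mul' (p k)
  rw [← h1, h.inner_comb, h2]
  exact Complex.ofReal_re _

lemma map_comb (h : IsJacobiChain M K b ℓ W) {p : ℕ → ℂ} (hp : p (ℓ + 1) = 0) :
    M (comb K ℓ p) = comb K ℓ (jacobi b p) + p ℓ • W := by
  have hdown : ∑ k ∈ range (ℓ + 1), (p k * b k) • K (k - 1) =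
      ∑ k ∈ range (ℓ + 1), (b (k + 1) * p (k + 1)) • K k := by
    rw [sum_range_succ', sum_range_succ]
    simp [h.b_zero, hp, mul_comm]
  have hup : ∑ k ∈ range ℓ, (p k * b (k + 1)) • K (k + 1) =
      ∑ k ∈ range (ℓ + 1), (b k * p (k - 1)) • K k := by
    rw [sum_range_succ' _ ℓ]
    simp [h.b_zero, mul_comm]
  have hl : M (comb K ℓ p) = ∑ k ∈ range (ℓ + 1), (p k * b k) • K (k - 1) +
      ∑ k ∈ range ℓ, (p k * b (k + 1)) • K (k + 1) + p ℓ • W := by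
    rw [comb, map_sum, sum_range_succ, sum_range_succ, map_smul, h.map_last,
      sum_congr rfl fun k hk => by rw [map_smul, h.map_eq k (mem_range.mp hk)]]
    simp only [smul_add, smul_smul, sum_add_distrib]
    abel
  rw [hl, hdown, hup, comb]
  simp only [jacobi, add_smul, sum_add_distrib]
  abel

lemma sum_norm_sq_jacobi_le (h : IsJacobiChain M K b ℓ W) {p : ℕ → ℂ} (hp : p (ℓ + 1) = 0) :
    ∑ k ∈ range (ℓ + 1), ‖jacobi b p k‖ ^ 2 ≤ (2 * b ℓ) ^ 2 * ∑ k ∈ range (ℓ + 1), ‖p k‖ ^ 2 := by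
  have hb := h.b_nonneg le_rfl
  have h1 : ∑ k ∈ range (ℓ + 1), ‖(b k : ℂ) * p (k - 1)‖ ^ 2 ≤
      b ℓ ^ 2 * ∑ k ∈ range (ℓ + 1), ‖p k‖ ^ 2 := by
    rw [sum_range_succ', mul_sum, sum_range_succ]
    simp only [h.b_zero, Complex.ofReal_zero, zero_mul, norm_zero, ne_eq, OfNat.ofNat_ne_zero,
      not_false_eq_true, zero_pow, add_zero, add_tsub_cancel_right]
    refine le_add_of_le_of_nonneg (sum_le_sum fun k hk => ?_) (by positivity)
    have hk' := mem_range.mp hk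
    rw [norm_mul, mul_pow, Complex.norm_real, Real.norm_eq_abs, sq_abs]
    have := h.b_mono (k + 1) ℓ (by omega) le_rfl
    have := h.b_nonneg (k := k + 1) (by omega)
    gcongr
  have h2 : ∑ k ∈ range (ℓ + 1), ‖(b (k + 1) : ℂ) * p (k + 1)‖ ^ 2 ≤
      b ℓ ^ 2 * ∑ k ∈ range (ℓ + 1), ‖p k‖ ^ 2 := by
    rw [sum_range_succ, hp, mul_sum, sum_range_succ' (fun k => b ℓ ^ 2 * ‖p k‖ ^ 2)]
    simp only [mul_zero, norm_zero, ne_eq, OfNat.ofNat_ne_zero, not_false_eq_true, zero_pow,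
      add_zero]
    refine le_add_of_le_of_nonneg (sum_le_sum fun k hk => ?_) (by positivity)
    have hk' := mem_range.mp hk
    rw [norm_mul, mul_pow, Complex.norm_real, Real.norm_eq_abs, sq_abs]
    have := h.b_mono (k + 1) ℓ (by omega) le_rfl
    have := h.b_nonneg (k := k + 1) (by omega)
    gcongr
  calc ∑ k ∈ range (ℓ + 1), ‖jacobi b p k‖ ^ 2
      ≤ ∑ k ∈ range (ℓ + 1), (2 * ‖(b k : ℂ) * p (k - 1)‖ ^ 2 +
          2 * ‖(b (k + 1) : ℂ) * p (k + 1)‖ ^ 2) := by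
        refine sum_le_sum fun k _ => ?_
        have := norm_add_le ((b k : ℂ) * p (k - 1)) ((b (k + 1) : ℂ) * p (k + 1))
        have h3 := pow_le_pow_left₀ (norm_nonneg _) this 2
        rw [jacobi]
        nlinarith [sq_nonneg (‖(b k : ℂ) * p (k - 1)‖ - ‖(b (k + 1) : ℂ) * p (k + 1)‖)]
    _ ≤ (2 * b ℓ) ^ 2 * ∑ k ∈ range (ℓ + 1), ‖p k‖ ^ 2 := by
        rw [sum_add_distrib, ← mul_sum, ← mul_sum]
        linarith

lemma norm_comb_jacobi_le (h : IsJacobiChain M K b ℓ W) {p : ℕ → ℂ} (hp : p (ℓ + 1) = 0) :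
    ‖comb K ℓ (jacobi b p)‖ ≤ 2 * b ℓ * ‖comb K ℓ p‖ := by
  have hb := h.b_nonneg le_rfl
  refine le_of_sq_le_sq ?_ (by positivity)
  rw [mul_pow, h.norm_sq_comb, h.norm_sq_comb]
  exact h.sum_norm_sq_jacobi_le hp

/-- Apart from the contribution of the last coefficient, `M` has norm at most `2 * b ℓ`. -/
lemma norm_map_comb_le (h : IsJacobiChain M K b ℓ W) {p : ℕ → ℂ} (hp : p (ℓ + 1) = 0) :
    ‖M (comb K ℓ p)‖ ≤ 2 * b ℓ * ‖comb K ℓ p‖ + ‖p ℓ‖ * ‖W‖ := by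
  rw [h.map_comb hp]
  refine (norm_add_le _ _).trans (add_le_add (h.norm_comb_jacobi_le hp) (norm_smul_le _ _))

lemma inner_comb_W (h : IsJacobiChain M K b ℓ W) (p : ℕ → ℂ) :
    inner ℂ (comb K ℓ p) W = star (p ℓ) * inner ℂ (K ℓ) W := by
  rw [comb, sum_inner, sum_range_succ, sum_eq_zero fun k hk => by
    rw [inner_smul_left, h.inner_W k (mem_range.mp hk), mul_zero]]
  rw [zero_add, inner_smul_left]
  rfl

lemma re_inner_map_comb (h : IsJacobiChain M K b ℓ W) {p : ℕ → ℂ} (hp : p (ℓ + 1) = 0) :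
    (inner ℂ (comb K ℓ p) (M (comb K ℓ p))).re =
      ∑ k ∈ range ℓ, 2 * b (k + 1) * (star (p k) * p (k + 1)).re +
        ‖p ℓ‖ ^ 2 * (inner ℂ (K ℓ) W).re := by
  have hdown : ∑ k ∈ range (ℓ + 1), star (p k) * (b (k + 1) * p (k + 1)) =
      ∑ k ∈ range ℓ, star (p k) * (b (k + 1) * p (k + 1)) := by
    rw [sum_range_succ, hp]; simp
  have hup : ∑ k ∈ range (ℓ + 1), star (p k) * (b k * p (k - 1)) =
      ∑ k ∈ range ℓ, star (p (k + 1)) * (b (k + 1) * p k) := by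
    rw [sum_range_succ', h.b_zero]; simp
  rw [h.map_comb hp, inner_add_right, h.inner_comb, inner_smul_right, h.inner_comb_W]
  simp only [jacobi, mul_add, sum_add_distrib]
  rw [hdown, hup, ← sum_add_distrib, Complex.add_re, Complex.re_sum, ← mul_assoc]
  congr 1
  · refine sum_congr rfl fun k _ => ?_
    simp [Complex.mul_re, Complex.mul_im]
    ring
  · have : p ℓ * star (p ℓ) = ((‖p ℓ‖ ^ 2 : ℝ) : ℂ) := by
      push_cast
      exact Complex.mul_conj' (p ℓ)
    rw [this, Complex.re_ofReal_mul]

/-- The bound `2 * b ℓ` for the norm of the tridiagonal matrix, with the loss that comes from the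
last coefficient. -/
lemma re_inner_map_comb_le (h : IsJacobiChain M K b ℓ W) {p : ℕ → ℂ} (hp : p (ℓ + 1) = 0) :
    (inner ℂ (comb K ℓ p) (M (comb K ℓ p))).re ≤
      b ℓ * (2 * ‖comb K ℓ p‖ ^ 2 - ‖p ℓ‖ ^ 2) + ‖p ℓ‖ ^ 2 * (inner ℂ (K ℓ) W).re := by
  have hb := h.b_nonneg le_rfl
  rw [h.re_inner_map_comb hp, add_le_add_iff_right, h.norm_sq_comb]
  calc ∑ k ∈ range ℓ, 2 * b (k + 1) * (star (p k) * p (k + 1)).re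
      ≤ ∑ k ∈ range ℓ, b ℓ * (‖p k‖ ^ 2 + ‖p (k + 1)‖ ^ 2) := by
        refine sum_le_sum fun k hk => ?_
        have hk' := mem_range.mp hk
        have h1 := h.b_mono (k + 1) ℓ (by omega) le_rfl
        have h2 := h.b_nonneg (k := k + 1) (by omega)
        have h3 : (star (p k) * p (k + 1)).re ≤ ‖p k‖ * ‖p (k + 1)‖ := by
          refine (Complex.re_le_norm _).trans ?_
          rw [norm_mul, norm_star]
        calc 2 * b (k + 1) * (star (p k) * p (k + 1)).re
            ≤ 2 * b (k + 1) * (‖p k‖ * ‖p (k + 1)‖) := by gcongr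
          _ ≤ 2 * b ℓ * (‖p k‖ * ‖p (k + 1)‖) := by gcongr
          _ ≤ b ℓ * (‖p k‖ ^ 2 + ‖p (k + 1)‖ ^ 2) := by
            nlinarith [mul_nonneg hb (sq_nonneg (‖p k‖ - ‖p (k + 1)‖))]
    _ ≤ b ℓ * (2 * ∑ k ∈ range (ℓ + 1), ‖p k‖ ^ 2 - ‖p ℓ‖ ^ 2) := by
        rw [← mul_sum, sum_add_distrib]
        have h1 := sum_range_succ (fun k => ‖p k‖ ^ 2) ℓ
        have h2 := sum_range_succ' (fun k => ‖p k‖ ^ 2) ℓ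
        have h3 := sq_nonneg ‖p 0‖
        refine mul_le_mul_of_nonneg_left ?_ hb
        linarith

lemma norm_sq_comb_windowCoeff (h : IsJacobiChain M K b ℓ W) {R : ℕ} (hR : 0 < R) (hRℓ : R ≤ ℓ) :
    ‖comb K ℓ (windowCoeff ℓ R)‖ ^ 2 = 1 := by
  have hR' : (0 : ℝ) < R := by exact_mod_cast hR
  rw [h.norm_sq_comb]
  have h1 : ∀ k, ‖windowCoeff ℓ R k‖ ^ 2 = if k ∈ Ico (ℓ - R) ℓ then (R : ℝ)⁻¹ else 0 := fun k => by
    simp only [windowCoeff, mem_Ico]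
    split_ifs
    · rw [Complex.norm_real, Real.norm_eq_abs, sq_abs, inv_pow, Real.sq_sqrt hR'.le]
    · simp
  simp only [h1]
  rw [← sum_filter, filter_mem_eq_inter, inter_eq_right.mpr, sum_const, Nat.card_Ico]
  · rw [Nat.sub_sub_self hRℓ, nsmul_eq_mul, mul_inv_cancel₀ hR'.ne']
  · intro k hk
    simp only [mem_Ico, mem_range] at hk ⊢
    omega

lemma le_re_inner_map_comb_windowCoeff (h : IsJacobiChain M K b ℓ W) {R : ℕ} (hR : 0 < R)
    (hRℓ : R ≤ ℓ) :
    2 * (1 - 1 / (R : ℝ)) * b (ℓ - R) ≤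
      (inner ℂ (comb K ℓ (windowCoeff ℓ R)) (M (comb K ℓ (windowCoeff ℓ R)))).re := by
  have hR' : (0 : ℝ) < R := by exact_mod_cast hR
  rw [h.re_inner_map_comb (by simp [windowCoeff])]
  have hlast : windowCoeff ℓ R ℓ = 0 := by simp [windowCoeff]
  rw [hlast, norm_zero, zero_pow two_ne_zero, zero_mul, add_zero]
  have hterm : ∀ k, (star (windowCoeff ℓ R k) * windowCoeff ℓ R (k + 1)).re =
      if ℓ - R ≤ k ∧ k + 1 < ℓ then (R : ℝ)⁻¹ else 0 := fun k => by
    have hs : (√(R : ℝ))⁻¹ * (√(R : ℝ))⁻¹ = (R : ℝ)⁻¹ := by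
      rw [← mul_inv, Real.mul_self_sqrt hR'.le]
    by_cases hk : ℓ - R ≤ k ∧ k + 1 < ℓ
    · rw [if_pos hk, windowCoeff, windowCoeff, if_pos (by omega), if_pos (by omega), ← hs]
      rw [Complex.star_def, Complex.conj_ofReal, ← Complex.ofReal_mul, Complex.ofReal_re]
    · rw [if_neg hk, windowCoeff, windowCoeff]
      by_cases h1 : ℓ - R ≤ k ∧ k < ℓ
      · rw [if_neg (c := ℓ - R ≤ k + 1 ∧ k + 1 < ℓ) (by omega)]; simp
      · rw [if_neg h1]; simp
  calc 2 * (1 - 1 / (R : ℝ)) * b (ℓ - R)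
      = ∑ _k ∈ Ico (ℓ - R) (ℓ - 1), 2 * b (ℓ - R) * (R : ℝ)⁻¹ := by
        rw [sum_const, Nat.card_Ico, show ℓ - 1 - (ℓ - R) = R - 1 by omega, nsmul_eq_mul,
          Nat.cast_sub hR]
        field_simp
        push_cast
        ring
    _ ≤ ∑ k ∈ Ico (ℓ - R) (ℓ - 1), 2 * b (k + 1) *
          (star (windowCoeff ℓ R k) * windowCoeff ℓ R (k + 1)).re := by
        refine sum_le_sum fun k hk => ?_
        rw [mem_Ico] at hk
        rw [hterm, if_pos (by omega)]
        have := h.b_mono (ℓ - R) (k + 1) (by omega) (by omega)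
        gcongr
    _ ≤ _ := by
        refine sum_le_sum_of_subset_of_nonneg ?_ fun k hk _ => ?_
        · intro k hk
          simp only [mem_Ico, mem_range] at hk ⊢
          omega
        · have := h.b_nonneg (k := k + 1) (by have := mem_range.mp hk; omega)
          rw [hterm]
          split_ifs <;> positivity

lemma jacobi_eq_zero {p : ℕ → ℂ} {k : ℕ} (hp : ∀ j, k < j → p j = 0) :
    ∀ j, k + 1 < j → jacobi b p j = 0 := fun j hj => by
  rw [jacobi, hp (j - 1) (by omega), hp (j + 1) (by omega)]; simp

/-- As long as `k ≤ ℓ`, the powers of `M` on `K 0` do not feel the cut-off at `ℓ`: the last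
coefficient is still zero before each application of `M`. -/
lemma exists_comb_eq_pow (h : IsJacobiChain M K b ℓ W) {k : ℕ} (hk : k ≤ ℓ) :
    ∃ p : ℕ → ℂ, (∀ j, k < j → p j = 0) ∧ (M ^ k) (K 0) = comb K ℓ p ∧
      ‖comb K ℓ p‖ ≤ (2 * b ℓ) ^ k := by
  induction k with
  | zero =>
    refine ⟨fun j => if j = 0 then 1 else 0, fun j hj => if_neg (by omega), ?_, ?_⟩
    · rw [comb_single K (Nat.zero_le ℓ)]; simp
    · rw [comb_single K (Nat.zero_le ℓ), pow_zero]
      have h2 : ‖K 0‖ ^ 2 = 1 := by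
        rw [← inner_self_eq_norm_sq (𝕜 := ℂ), h.inner_eq 0 (Nat.zero_le _) 0 (Nat.zero_le _),
          if_pos rfl]
        exact RCLike.one_re
      nlinarith [norm_nonneg (K 0)]
  | succ k ih =>
    obtain ⟨p, hp, hpow, hn⟩ := ih (by omega)
    refine ⟨jacobi b p, jacobi_eq_zero hp, ?_, ?_⟩
    · rw [pow_succ', Module.End.mul_apply, hpow, h.map_comb (hp _ (by omega)), hp ℓ (by omega)]
      simp
    · have hb := h.b_nonneg le_rfl
      refine (h.norm_comb_jacobi_le (hp _ (by omega))).trans ?_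
      rw [pow_succ']
      gcongr

end IsJacobiChain

end Jacobi

end

/-! ### The objective as a Jacobi matrix on DQI states -/

section

variable {m n : ℕ}

/-- A real function on bitstrings as a state vector. -/
noncomputable def realVec (g : Bits n → ℝ) : StateVec n := WithLp.toLp 2 fun x => (g x : ℂ)

lemma realVec_apply (g : Bits n → ℝ) (x : Bits n) : realVec g x = (g x : ℂ) := rfl

lemma inner_realVec (g h : Bits n → ℝ) :
    inner ℂ (realVec g) (realVec h) = ((∑ x, g x * h x : ℝ) : ℂ) := by
  rw [PiLp.inner_apply]
  push_cast
  refine sum_congr rfl fun x _ => ?_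
  simp [realVec_apply, mul_comm]

/-- The observable `f`: multiplication of a state vector by the objective. -/
noncomputable def objOp (B : Matrix (Fin m) (Fin n) (ZMod 2)) (v : Bits m) :
    StateVec n →ₗ[ℂ] StateVec n where
  toFun ψ := WithLp.toLp 2 fun x => (objective B v x : ℂ) * ψ x
  map_add' ψ φ := by ext x; simp [mul_add]
  map_smul' c ψ := by ext x; simp; ring

variable (B : Matrix (Fin m) (Fin n) (ZMod 2)) (v : Bits m)

lemma objOp_apply (ψ : StateVec n) (x : Bits n) :
    objOp B v ψ x = (objective B v x : ℂ) * ψ x := rfl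

lemma objOp_realVec (g : Bits n → ℝ) :
    objOp B v (realVec g) = realVec fun x => objective B v x * g x := by
  ext x
  rw [objOp_apply, realVec_apply, realVec_apply]
  push_cast
  rfl

lemma objOp_pow_apply (k : ℕ) (ψ : StateVec n) (x : Bits n) :
    (objOp B v ^ k) ψ x = (objective B v x : ℂ) ^ k * ψ x := by
  induction k with
  | zero => simp
  | succ k ih => rw [pow_succ', Module.End.mul_apply, objOp_apply, ih]; ring

lemma norm_sq_objOp (ψ : StateVec n) :
    ‖objOp B v ψ‖ ^ 2 = ∑ x, ‖ψ x‖ ^ 2 * objective B v x ^ 2 := by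
  rw [EuclideanSpace.norm_sq_eq]
  refine sum_congr rfl fun x _ => ?_
  rw [objOp_apply, norm_mul, mul_pow, Complex.norm_real, Real.norm_eq_abs, sq_abs, mul_comm]

lemma norm_objOp_le (ψ : StateVec n) : ‖objOp B v ψ‖ ≤ m * ‖ψ‖ := by
  refine le_of_sq_le_sq ?_ (by positivity)
  rw [norm_sq_objOp, mul_pow, EuclideanSpace.norm_sq_eq, mul_sum]
  refine sum_le_sum fun x _ => ?_
  rw [mul_comm]
  have := sq_le_sq' (abs_le.mp (abs_objective_le B v x)).1 (abs_le.mp (abs_objective_le B v x)).2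
  gcongr

lemma re_inner_objOp (ψ : StateVec n) :
    (inner ℂ ψ (objOp B v ψ)).re = expectedObjective B v ψ := by
  rw [PiLp.inner_apply, Complex.re_sum, expectedObjective]
  refine sum_congr rfl fun x _ => ?_
  have : inner ℂ (ψ x) (objOp B v ψ x) = ((‖ψ x‖ ^ 2 * objective B v x : ℝ) : ℂ) := by
    rw [objOp_apply]
    push_cast
    rw [← Complex.mul_conj' (ψ x)]
    simp only [RCLike.inner_apply]
    ring
  rw [this, Complex.ofReal_re]

/-- Chebyshev's inequality for the measured value of the objective. -/
lemma measureProb_mul_sq_le {ψ : StateVec n} (hψ : ‖ψ‖ = 1) {a : ℝ}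
    (ha : a ≤ expectedObjective B v ψ) :
    measureProb ψ {x | objective B v x < a} * (expectedObjective B v ψ - a) ^ 2 ≤
      ‖objOp B v ψ‖ ^ 2 - expectedObjective B v ψ ^ 2 := by
  set θ := expectedObjective B v ψ with hθ
  have h1 : ∑ x, ‖ψ x‖ ^ 2 = 1 := by rw [← EuclideanSpace.norm_sq_eq, hψ, one_pow]
  have h2 : ‖objOp B v ψ‖ ^ 2 - θ ^ 2 = ∑ x, ‖ψ x‖ ^ 2 * (objective B v x - θ) ^ 2 := by
    have : ∀ x, ‖ψ x‖ ^ 2 * (objective B v x - θ) ^ 2 = ‖ψ x‖ ^ 2 * objective B v x ^ 2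
        - 2 * θ * (‖ψ x‖ ^ 2 * objective B v x) + θ ^ 2 * ‖ψ x‖ ^ 2 := fun x => by ring
    simp only [this, sum_add_distrib, sum_sub_distrib, ← mul_sum]
    rw [h1, norm_sq_objOp, ← expectedObjective, ← hθ]
    ring
  rw [h2, measureProb, sum_mul]
  refine (sum_le_sum fun x hx => ?_).trans
    (sum_le_sum_of_subset_of_nonneg (subset_univ _) fun x _ _ => by positivity)
  have hx' : objective B v x < a := by simpa using hx
  have : (θ - a) ^ 2 ≤ (objective B v x - θ) ^ 2 := by nlinarith
  gcongr

/-- The off-diagonal entries `√(k (m - k + 1))` of the Jacobi matrix of the binary Krawtchouk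
polynomials. -/
noncomputable def offDiag (m k : ℕ) : ℝ := √(k * (m - k + 1))

/-- The normalization `√(2 ^ n * (m choose k))` of `esymm B v k`. -/
noncomputable def kNorm (m n k : ℕ) : ℝ := √(2 ^ n * m.choose k)

/-- The normalized elementary symmetric polynomials, as state vectors. -/
noncomputable def kVec (k : ℕ) : StateVec n := realVec fun x => esymm B v k x / kNorm m n k

/-- The part of `objOp B v (kVec B v ℓ)` of degree `ℓ + 1`. -/
noncomputable def boundaryVec (ℓ : ℕ) : StateVec n :=
  realVec fun x => (ℓ + 1) * esymm B v (ℓ + 1) x / kNorm m n ℓ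

lemma kNorm_pos {k : ℕ} (hk : k ≤ m) : 0 < kNorm m n k := by
  have : (0 : ℝ) < m.choose k := by exact_mod_cast Nat.choose_pos hk
  exact Real.sqrt_pos.mpr (by positivity)

lemma kNorm_sq (k : ℕ) : kNorm m n k ^ 2 = 2 ^ n * m.choose k :=
  Real.sq_sqrt (by positivity)

lemma offDiag_succ_sq {k : ℕ} (hk : k ≤ m) : offDiag m (k + 1) ^ 2 = (k + 1) * (m - k) := by
  have : (k : ℝ) ≤ m := by exact_mod_cast hk
  have h : (((k + 1 : ℕ) : ℝ)) * (m - ((k + 1 : ℕ) : ℝ) + 1) = (k + 1) * (m - k) := by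
    push_cast; ring
  rw [offDiag, h]
  exact Real.sq_sqrt (mul_nonneg (by positivity) (by linarith))

lemma cast_choose_succ_mul {k : ℕ} (hk : k ≤ m) :
    (m.choose (k + 1) : ℝ) * (k + 1) = m.choose k * (m - k) := by
  have h := Nat.choose_succ_right_eq m k
  have h' : ((m.choose (k + 1) * (k + 1) : ℕ) : ℝ) = ((m.choose k * (m - k) : ℕ) : ℝ) := by rw [h]
  rw [Nat.cast_mul, Nat.cast_mul, Nat.cast_sub hk] at h'
  exact_mod_cast h'

lemma offDiag_succ_mul_kNorm {k : ℕ} (hk : k < m) :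
    offDiag m (k + 1) * kNorm m n k = (k + 1) * kNorm m n (k + 1) := by
  have h1 : 0 ≤ offDiag m (k + 1) := Real.sqrt_nonneg _
  have h2 := kNorm_pos (n := n) hk.le
  have h3 := kNorm_pos (n := n) (Nat.succ_le_of_lt hk)
  rw [← sq_eq_sq₀ (by positivity) (by positivity), mul_pow, mul_pow, offDiag_succ_sq hk.le,
    kNorm_sq, kNorm_sq]
  linear_combination (-((k : ℝ) + 1) * 2 ^ n) * cast_choose_succ_mul hk.le

lemma offDiag_succ_mul_kNorm_succ {k : ℕ} (hk : k < m) :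
    offDiag m (k + 1) * kNorm m n (k + 1) = (m - k) * kNorm m n k := by
  have h1 : 0 ≤ offDiag m (k + 1) := Real.sqrt_nonneg _
  have h2 := kNorm_pos (n := n) hk.le
  have h3 := kNorm_pos (n := n) (Nat.succ_le_of_lt hk)
  have h4 : (0 : ℝ) ≤ m - k := sub_nonneg.mpr (by exact_mod_cast hk.le)
  rw [← sq_eq_sq₀ (by positivity) (by positivity), mul_pow, mul_pow, offDiag_succ_sq hk.le,
    kNorm_sq, kNorm_sq]
  linear_combination (((m : ℝ) - k) * 2 ^ n) * cast_choose_succ_mul hk.le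

lemma offDiag_zero : offDiag m 0 = 0 := by simp [offDiag]

lemma offDiag_mono {ℓ : ℕ} (hℓ : 2 * ℓ ≤ m) {j k : ℕ} (hjk : j ≤ k) (hk : k ≤ ℓ) :
    offDiag m j ≤ offDiag m k := by
  refine Real.sqrt_le_sqrt ?_
  have h1 : (j : ℝ) ≤ k := by exact_mod_cast hjk
  have h2 : (k : ℝ) ≤ ℓ := by exact_mod_cast hk
  have h3 : 2 * (ℓ : ℝ) ≤ m := by exact_mod_cast hℓ
  nlinarith [mul_nonneg (sub_nonneg.mpr h1) (by linarith : (0 : ℝ) ≤ m + 1 - k - j)]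

lemma objOp_kVec {k : ℕ} (hk : k ≤ m) :
    objOp B v (kVec B v k) = (offDiag m k : ℂ) • kVec B v (k - 1) + boundaryVec B v k := by
  ext x
  simp only [kVec, objOp_realVec, PiLp.add_apply, PiLp.smul_apply, realVec_apply, boundaryVec,
    smul_eq_mul]
  norm_cast
  rcases k with _ | k
  · rw [offDiag_zero, zero_mul, zero_add, ← mul_div_assoc, objective_mul_esymm_zero]
    simp
  · have h1 := kNorm_pos (n := n) hk
    have h2 := kNorm_pos (n := n) (show k ≤ m by omega)
    rw [← mul_div_assoc, objective_mul_esymm_succ, add_tsub_cancel_right, ← mul_div_assoc,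
      div_add_div _ _ h2.ne' h1.ne', div_eq_div_iff h1.ne' (by positivity)]
    push_cast
    linear_combination (-kNorm m n (k + 1) * esymm B v k x) *
      offDiag_succ_mul_kNorm_succ (n := n) (show k < m by omega)

lemma boundaryVec_eq {k : ℕ} (hk : k < m) :
    boundaryVec B v k = (offDiag m (k + 1) : ℂ) • kVec B v (k + 1) := by
  ext x
  simp only [kVec, PiLp.smul_apply, realVec_apply, boundaryVec, smul_eq_mul]
  norm_cast
  have h1 := kNorm_pos (n := n) hk.le
  have h2 := kNorm_pos (n := n) (Nat.succ_le_of_lt hk)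
  rw [← mul_div_assoc, div_eq_div_iff h1.ne' h2.ne']
  push_cast
  linear_combination (-esymm B v (k + 1) x) * offDiag_succ_mul_kNorm (n := n) hk

variable {B}

lemma inner_kVec {ℓ : ℕ} (hB : DualDistGT B ℓ) (hℓ : ℓ ≤ m) {j k : ℕ} (hj : j ≤ ℓ) (hk : k ≤ ℓ) :
    inner ℂ (kVec B v j) (kVec B v k) = if j = k then (1 : ℂ) else 0 := by
  rw [kVec, kVec, inner_realVec]
  simp only [div_mul_div_comm]
  rw [← sum_div, sum_esymm_mul_esymm v hB (by omega)]
  split_ifs with h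
  · subst h
    rw [← kNorm_sq, sq, div_self (mul_self_ne_zero.mpr (kNorm_pos (hj.trans hℓ)).ne')]
    simp
  · simp

lemma isJacobiChain_kVec {ℓ : ℕ} (hB : DualDistGT B ℓ) (hℓ : 2 * ℓ ≤ m) :
    IsJacobiChain (objOp B v) (kVec B v) (offDiag m) ℓ (boundaryVec B v ℓ) where
  inner_eq j hj k hk := inner_kVec v hB (by omega) hj hk
  b_zero := offDiag_zero
  b_mono j k hjk hk := offDiag_mono hℓ hjk hk
  map_eq k hk := by rw [objOp_kVec B v (by omega), boundaryVec_eq B v (by omega)]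
  map_last := objOp_kVec B v (by omega)
  inner_W j hj := by
    rw [kVec, boundaryVec, inner_realVec]
    simp only [div_mul_div_comm, mul_left_comm _ ((ℓ : ℝ) + 1)]
    rw [← sum_div, ← mul_sum, sum_esymm_mul_esymm v hB (by omega), if_neg (by omega)]
    simp

lemma dqiVec_apply (P : Polynomial ℂ) (x : Bits n) :
    dqiVec B v P x = P.eval (objective B v x : ℂ) := rfl

lemma dqiVec_eq_sum {ℓ : ℕ} {P : Polynomial ℂ} (hP : P.natDegree ≤ ℓ) :
    dqiVec B v P = ∑ j ∈ range (ℓ + 1),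
      (P.coeff j * (kNorm m n 0 : ℂ)) • (objOp B v ^ j) (kVec B v 0) := by
  ext x
  have h0 : (kNorm m n 0 : ℂ) ≠ 0 := by
    exact_mod_cast (kNorm_pos (m := m) (n := n) (Nat.zero_le m)).ne'
  rw [dqiVec_apply, Polynomial.eval_eq_sum_range' (Nat.lt_succ_iff.mpr hP), WithLp.ofLp_sum, Finset.sum_apply]
  refine sum_congr rfl fun j _ => ?_
  rw [PiLp.smul_apply, objOp_pow_apply, kVec, realVec_apply, esymm_zero]
  push_cast
  rw [smul_eq_mul]
  field_simp

lemma exists_comb_eq_dqiVec {ℓ : ℕ} (hB : DualDistGT B ℓ) (hℓ : 2 * ℓ ≤ m) {P : Polynomial ℂ}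
    (hP : P.natDegree ≤ ℓ) :
    ∃ p : ℕ → ℂ, p (ℓ + 1) = 0 ∧ dqiVec B v P = comb (kVec B v) ℓ p := by
  have hc := isJacobiChain_kVec v hB hℓ
  have hex : ∀ j, ∃ p : ℕ → ℂ, j ≤ ℓ → p (ℓ + 1) = 0 ∧
      (objOp B v ^ j) (kVec B v 0) = comb (kVec B v) ℓ p := fun j => by
    by_cases hj : j ≤ ℓ
    · obtain ⟨p, hp, he, -⟩ := hc.exists_comb_eq_pow hj
      exact ⟨p, fun _ => ⟨hp _ (by omega), he⟩⟩
    · exact ⟨0, fun h => absurd h hj⟩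
  choose q hq using hex
  refine ⟨fun k => ∑ j ∈ range (ℓ + 1), (P.coeff j * (kNorm m n 0 : ℂ)) * q j k, ?_, ?_⟩
  · exact sum_eq_zero fun j hj => by rw [(hq j (mem_range_succ_iff.mp hj)).1, mul_zero]
  · rw [dqiVec_eq_sum v hP, ← sum_smul_comb]
    exact sum_congr rfl fun j hj => by rw [(hq j (mem_range_succ_iff.mp hj)).2]

variable (B) in
lemma exists_esymm_eq_eval (k : ℕ) : ∃ P : Polynomial ℂ, P.natDegree ≤ k ∧
    ∀ x, (esymm B v k x : ℂ) = P.eval (objective B v x : ℂ) := by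
  induction k using Nat.strong_induction_on with
  | _ k ih =>
    match k with
    | 0 => exact ⟨1, by simp, fun x => by simp [esymm_zero]⟩
    | 1 =>
      refine ⟨Polynomial.X, by simp, fun x => ?_⟩
      rw [Polynomial.eval_X, ← objective_mul_esymm_zero, esymm_zero, mul_one]
    | k + 2 =>
      obtain ⟨P, hP, hPe⟩ := ih k (by omega)
      obtain ⟨Q, hQ, hQe⟩ := ih (k + 1) (by omega)
      refine ⟨Polynomial.C ((k : ℂ) + 2)⁻¹ *
        (Polynomial.X * Q - Polynomial.C ((m : ℂ) - k) * P), ?_, fun x => ?_⟩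
      · refine (Polynomial.natDegree_C_mul_le _ _).trans
          ((Polynomial.natDegree_sub_le _ _).trans (max_le ?_ ?_))
        · refine Polynomial.natDegree_mul_le.trans ?_
          rw [Polynomial.natDegree_X]
          omega
        · exact (Polynomial.natDegree_C_mul_le _ _).trans (by omega)
      · simp only [Polynomial.eval_mul, Polynomial.eval_C, Polynomial.eval_sub, Polynomial.eval_X,
          ← hPe, ← hQe]
        have h := congrArg (fun r : ℝ => (r : ℂ)) (objective_mul_esymm_succ B v k x)
        push_cast at h
        have hk : (k : ℂ) + 2 ≠ 0 := by exact_mod_cast Nat.succ_ne_zero (k + 1)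
        rw [h]
        field_simp
        ring

variable (B) in
lemma exists_dqiVec_eq_comb (ℓ : ℕ) (p : ℕ → ℂ) : ∃ P : Polynomial ℂ, P.natDegree ≤ ℓ ∧
    comb (kVec B v) ℓ p = dqiVec B v P := by
  choose Q hQ hQe using exists_esymm_eq_eval B v
  refine ⟨∑ k ∈ range (ℓ + 1), Polynomial.C (p k / (kNorm m n k : ℂ)) * Q k, ?_, ?_⟩
  · refine Polynomial.natDegree_sum_le_of_forall_le _ _ fun k hk => ?_
    exact (Polynomial.natDegree_C_mul_le _ _).trans ((hQ k).trans (mem_range_succ_iff.mp hk))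
  · ext x
    rw [comb, WithLp.ofLp_sum, Finset.sum_apply, dqiVec_apply, Polynomial.eval_finsetSum]
    refine sum_congr rfl fun k _ => ?_
    rw [PiLp.smul_apply, kVec, realVec_apply, Polynomial.eval_mul, Polynomial.eval_C, ← hQe]
    push_cast
    rw [smul_eq_mul]
    ring

end

/-! ### Concentration of optimal DQI states -/

section

variable {m n : ℕ} {B : Matrix (Fin m) (Fin n) (ZMod 2)} (v : Bits m)

lemma norm_kVec {ℓ : ℕ} (hB : DualDistGT B ℓ) (hℓ : ℓ ≤ m) {k : ℕ} (hk : k ≤ ℓ) :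
    ‖kVec B v k‖ = 1 := by
  have h : ‖kVec B v k‖ ^ 2 = 1 := by
    rw [← inner_self_eq_norm_sq (𝕜 := ℂ), inner_kVec v hB hℓ hk hk, if_pos rfl]
    exact RCLike.one_re
  nlinarith [norm_nonneg (kVec B v k)]

lemma choose_le_choose_of_le {k ℓ : ℕ} (hk : k ≤ ℓ) (hℓ : 2 * ℓ ≤ m) :
    m.choose k ≤ m.choose ℓ := by
  induction ℓ, hk using Nat.le_induction with
  | base => rfl
  | succ ℓ _ ih =>
    exact (ih (by omega)).trans (Nat.choose_le_succ_of_lt_half_left (by omega))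

lemma norm_sq_kVec_apply_le (k : ℕ) (hk : k ≤ m) (x : Bits n) :
    ‖kVec B v k x‖ ^ 2 ≤ m.choose k / 2 ^ n := by
  have hc : (0 : ℝ) < m.choose k := by exact_mod_cast Nat.choose_pos hk
  have h1 : ‖kVec B v k x‖ ^ 2 = esymm B v k x ^ 2 / (2 ^ n * m.choose k) := by
    rw [kVec, realVec_apply, Complex.norm_real, Real.norm_eq_abs, sq_abs, div_pow, kNorm_sq]
  have h2 := abs_le.mp (abs_esymm_le B v k x)
  have h3 := sq_le_sq' h2.1 h2.2
  rw [h1, div_le_div_iff₀ (by positivity) (by positivity)]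
  have h4 : (0 : ℝ) ≤ 2 ^ n := by positivity
  linear_combination mul_le_mul_of_nonneg_right h3 h4

/-- A DQI state has no large amplitude: the Christoffel function of the Krawtchouk polynomials is
largest at the end point `f = m`, where it is a sum of binomial coefficients. -/
lemma norm_sq_apply_le {ℓ : ℕ} (hB : DualDistGT B ℓ) (hℓ : 2 * ℓ ≤ m) {ψ : StateVec n}
    (hψ : IsDQIState B v ℓ ψ) (x : Bits n) :
    ‖ψ x‖ ^ 2 ≤ (ℓ + 1) * m.choose ℓ / 2 ^ n := by
  obtain ⟨hnorm, P, hP, rfl⟩ := hψ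
  obtain ⟨p, -, hp⟩ := exists_comb_eq_dqiVec v hB hℓ hP
  have hsum := (isJacobiChain_kVec v hB hℓ).norm_sq_comb p
  rw [← hp, hnorm, one_pow] at hsum
  have hx : ‖dqiVec B v P x‖ ≤ ∑ k ∈ range (ℓ + 1), ‖p k‖ * ‖kVec B v k x‖ := by
    rw [hp, comb, WithLp.ofLp_sum, Finset.sum_apply]
    refine (norm_sum_le _ _).trans (sum_le_sum fun k _ => ?_)
    rw [PiLp.smul_apply, norm_smul]
  calc ‖dqiVec B v P x‖ ^ 2 ≤ (∑ k ∈ range (ℓ + 1), ‖p k‖ * ‖kVec B v k x‖) ^ 2 := by gcongr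
    _ ≤ (∑ k ∈ range (ℓ + 1), ‖p k‖ ^ 2) * ∑ k ∈ range (ℓ + 1), ‖kVec B v k x‖ ^ 2 :=
        sum_mul_sq_le_sq_mul_sq _ _ _
    _ ≤ ∑ _k ∈ range (ℓ + 1), (m.choose ℓ : ℝ) / 2 ^ n := by
        rw [← hsum, one_mul]
        refine sum_le_sum fun k hk => ?_
        have hk' := mem_range_succ_iff.mp hk
        refine (norm_sq_kVec_apply_le v k (by omega) x).trans ?_
        have : (m.choose k : ℝ) ≤ m.choose ℓ := by exact_mod_cast choose_le_choose_of_le hk' hℓ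
        gcongr
    _ = (ℓ + 1) * m.choose ℓ / 2 ^ n := by
        rw [sum_const, card_range, nsmul_eq_mul]
        push_cast
        ring

/-- Markov's inequality for the moment of order `2 * ℓ` of the objective at a uniform bitstring: up
to the factor `√(2 ^ n)`, the vector of the values `f(x) ^ ℓ` is the `ℓ`-th power of the Jacobi
matrix applied to the constant vector. -/
lemma card_le_objective_mul_pow_le {ℓ : ℕ} (hB : DualDistGT B ℓ) (hℓ : 2 * ℓ ≤ m) {a : ℝ}
    (ha : 0 ≤ a) :
    (#{x | a ≤ objective B v x} : ℝ) * (a ^ 2) ^ ℓ ≤ 2 ^ n * ((2 * offDiag m ℓ) ^ 2) ^ ℓ := by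
  obtain ⟨p, -, hp, hle⟩ := (isJacobiChain_kVec v hB hℓ).exists_comb_eq_pow le_rfl
  rw [← hp] at hle
  have h1 : ‖(objOp B v ^ ℓ) (kVec B v 0)‖ ^ 2 * 2 ^ n = ∑ x, (objective B v x ^ 2) ^ ℓ := by
    rw [EuclideanSpace.norm_sq_eq, sum_mul]
    refine sum_congr rfl fun x _ => ?_
    rw [objOp_pow_apply, norm_mul, mul_pow, norm_pow, Complex.norm_real, kVec, realVec_apply,
      Complex.norm_real, Real.norm_eq_abs, Real.norm_eq_abs, sq_abs, esymm_zero, div_pow,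
      kNorm_sq, pow_right_comm, sq_abs]
    simp
  have h2 : ‖(objOp B v ^ ℓ) (kVec B v 0)‖ ^ 2 ≤ ((2 * offDiag m ℓ) ^ 2) ^ ℓ := by
    rw [pow_right_comm]
    gcongr
  calc (#{x | a ≤ objective B v x} : ℝ) * (a ^ 2) ^ ℓ
      = ∑ x with a ≤ objective B v x, (a ^ 2) ^ ℓ := by simp
    _ ≤ ∑ x with a ≤ objective B v x, (objective B v x ^ 2) ^ ℓ := by
        refine sum_le_sum fun x hx => ?_
        have : a ≤ objective B v x := by simpa using hx
        gcongr
    _ ≤ ∑ x, (objective B v x ^ 2) ^ ℓ :=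
        sum_le_sum_of_subset_of_nonneg (subset_univ _) fun x _ _ => by positivity
    _ ≤ 2 ^ n * ((2 * offDiag m ℓ) ^ 2) ^ ℓ := by
        rw [← h1, mul_comm]
        gcongr

lemma offDiag_sq {k : ℕ} (hk : k ≤ m) : offDiag m k ^ 2 = k * (m - k + 1) := by
  have : (k : ℝ) ≤ m := by exact_mod_cast hk
  exact Real.sq_sqrt (mul_nonneg (Nat.cast_nonneg k) (by linarith))

lemma offDiag_sq_le {k : ℕ} (hk : k ≤ m) : offDiag m k ^ 2 ≤ k * m := by
  rw [offDiag_sq hk]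
  rcases k with _ | k
  · simp
  · refine mul_le_mul_of_nonneg_left ?_ (Nat.cast_nonneg _)
    push_cast
    linarith [(Nat.cast_nonneg k : (0 : ℝ) ≤ k)]

/-- Large values of the objective are exponentially rare among all bitstrings. -/
lemma card_le_objective_mul_two_pow_le {ℓ k : ℕ} (hB : DualDistGT B ℓ) (hℓ : 2 * ℓ ≤ m)
    (hm : 0 < m) (hk : k ≤ ℓ) {lam : ℝ} (hlam : 0 < lam) (hklam : (k : ℝ) ≤ lam ^ 2 * m / 8) :
    (#{x | lam * m ≤ objective B v x} : ℝ) * 2 ^ k ≤ 2 ^ n := by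
  have hm' : (0 : ℝ) < m := by exact_mod_cast hm
  have hBk : DualDistGT B k := fun S T h h' => by
    have := hB S T h h'
    omega
  have h := card_le_objective_mul_pow_le v hBk (by omega) (a := lam * m) (by positivity)
  have h1 : (2 * offDiag m k) ^ 2 ≤ (lam * m) ^ 2 / 2 := by
    have := offDiag_sq_le (m := m) (k := k) (by omega)
    nlinarith
  have h2 : (2 : ℝ) ^ n * ((2 * offDiag m k) ^ 2) ^ k ≤ 2 ^ n * ((lam * m) ^ 2 / 2) ^ k := by
    gcongr
  have h3 := h.trans h2
  rw [div_pow, ← mul_div_assoc, le_div_iff₀ (by positivity)] at h3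
  have h4 : 0 < ((lam * m) ^ 2) ^ k := by positivity
  nlinarith

lemma norm_boundaryVec_le {ℓ : ℕ} (hB : DualDistGT B ℓ) (hℓ : ℓ ≤ m) :
    ‖boundaryVec B v ℓ‖ ≤ 2 * m := by
  have hb : offDiag m ℓ ≤ m := by
    have h1 := offDiag_sq_le hℓ
    have h2 : (ℓ : ℝ) ≤ m := by exact_mod_cast hℓ
    refine le_of_sq_le_sq ?_ (Nat.cast_nonneg m)
    nlinarith [(Nat.cast_nonneg m : (0 : ℝ) ≤ m)]
  have h := objOp_kVec B v hℓ
  rw [← sub_eq_iff_eq_add'] at h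
  rw [← h]
  refine (norm_sub_le _ _).trans ?_
  have h1 := norm_objOp_le B v (kVec B v ℓ)
  rw [norm_kVec v hB hℓ le_rfl] at h1
  rw [norm_smul, norm_kVec v hB hℓ (Nat.sub_le ℓ 1), Complex.norm_real, Real.norm_eq_abs,
    abs_of_nonneg (show 0 ≤ offDiag m ℓ from Real.sqrt_nonneg _)]
  linarith

/-- The corner entry that the dual codewords of weight `2 * ℓ + 1` add to the Jacobi matrix. -/
lemma re_inner_kVec_boundaryVec_mul_le {ℓ : ℕ} (hB : DualDistGT B ℓ) (hℓ : 2 * ℓ + 1 ≤ m) {N : ℝ}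
    (h : ∀ s, (#(cosetWords B (ℓ + 2) s) : ℝ) ≤ N) :
    (inner ℂ (kVec B v ℓ) (boundaryVec B v ℓ)).re * (m - 2 * ℓ - 1) ≤ N * (m - ℓ) := by
  have hc : (0 : ℝ) < m.choose ℓ := by exact_mod_cast Nat.choose_pos (by omega)
  have hpos : (0 : ℝ) ≤ m - 2 * ℓ - 1 := by
    have : (2 * (ℓ : ℝ) + 1) ≤ m := by exact_mod_cast hℓ
    linarith
  have h1 : (inner ℂ (kVec B v ℓ) (boundaryVec B v ℓ)).re =
      (ℓ + 1) * (∑ x, esymm B v ℓ x * esymm B v (ℓ + 1) x) / (2 ^ n * m.choose ℓ) := by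
    rw [kVec, boundaryVec, inner_realVec, Complex.ofReal_re]
    simp only [div_mul_div_comm, mul_left_comm _ ((ℓ : ℝ) + 1)]
    rw [← sum_div, ← mul_sum, ← kNorm_sq, sq]
  have h2 := sum_esymm_mul_esymm_succ_le (B := B) v ℓ
  have h3 := card_boundaryPairs_mul_le hB h
  have h4 := cast_choose_succ_mul (m := m) (k := ℓ) (by omega)
  rw [h1, div_mul_eq_mul_div, div_le_iff₀ (by positivity)]
  calc (ℓ + 1) * (∑ x, esymm B v ℓ x * esymm B v (ℓ + 1) x) * ((m : ℝ) - 2 * ℓ - 1)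
      ≤ (ℓ + 1) * (2 ^ n * #(boundaryPairs B ℓ)) * ((m : ℝ) - 2 * ℓ - 1) := by gcongr
    _ = (ℓ + 1) * 2 ^ n * (#(boundaryPairs B ℓ) * ((m : ℝ) - 2 * ℓ - 1)) := by ring
    _ ≤ (ℓ + 1) * 2 ^ n * (N * m.choose (ℓ + 1)) := by gcongr
    _ = N * (m - ℓ) * (2 ^ n * m.choose ℓ) := by linear_combination (N * 2 ^ n) * h4

lemma offDiag_sub_ge {ℓ R : ℕ} (hℓ : ℓ ≤ m) (hR : R ≤ ℓ) (hℓ0 : 0 < ℓ) :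
    (1 - (R : ℝ) / ℓ) * offDiag m ℓ ≤ offDiag m (ℓ - R) := by
  have hℓ' : (0 : ℝ) < ℓ := by exact_mod_cast hℓ0
  have h0 : (0 : ℝ) ≤ R / ℓ := by positivity
  have h1 : (R : ℝ) / ℓ ≤ 1 := (div_le_one hℓ').mpr (by exact_mod_cast hR)
  have h2 : (ℓ : ℝ) ≤ m := by exact_mod_cast hℓ
  refine le_of_sq_le_sq ?_ (Real.sqrt_nonneg _)
  rw [mul_pow, offDiag_sq hℓ, offDiag_sq (by omega), Nat.cast_sub hR]
  have h3 : (1 - (R : ℝ) / ℓ) * ℓ = ℓ - R := by field_simp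
  have h4 : (0 : ℝ) ≤ ℓ - R := by rw [← h3]; exact mul_nonneg (by linarith) hℓ'.le
  calc (1 - (R : ℝ) / ℓ) ^ 2 * (ℓ * (m - ℓ + 1))
      = (1 - (R : ℝ) / ℓ) * ((ℓ - R) * (m - ℓ + 1)) := by rw [← h3]; ring
    _ ≤ 1 * ((ℓ - R) * (m - ℓ + 1)) :=
        mul_le_mul_of_nonneg_right (by linarith) (mul_nonneg h4 (by linarith))
    _ ≤ (ℓ - R) * (m - (ℓ - R) + 1) := by
        rw [one_mul]
        refine mul_le_mul_of_nonneg_left ?_ h4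
        linarith [(Nat.cast_nonneg R : (0 : ℝ) ≤ R)]

/-- The trial state with a flat window of coefficients nearly attains the value `2 * offDiag m ℓ`,
which is an upper bound up to the corner entry. -/
lemma le_expectedObjective {ℓ R : ℕ} (hB : DualDistGT B ℓ) (hℓ : 2 * ℓ ≤ m) (hR : 0 < R)
    (hRℓ : R ≤ ℓ) {ψ : StateVec n} (hψ : IsOptimalDQIState B v ℓ ψ) {η : ℝ}
    (hη : 1 / (R : ℝ) + R / ℓ ≤ η) :
    2 * (1 - η) * offDiag m ℓ ≤ expectedObjective B v ψ := by
  have hc := isJacobiChain_kVec v hB hℓ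
  obtain ⟨P, hP, hPe⟩ := exists_dqiVec_eq_comb B v ℓ (windowCoeff ℓ R)
  have hnorm := hc.norm_sq_comb_windowCoeff hR hRℓ
  have h1 := hψ.2 (comb (kVec B v) ℓ (windowCoeff ℓ R))
    ⟨by nlinarith [norm_nonneg (comb (kVec B v) ℓ (windowCoeff ℓ R))], P, hP, hPe⟩
  have h2 := hc.le_re_inner_map_comb_windowCoeff hR hRℓ
  rw [re_inner_objOp] at h2
  have h3 := offDiag_sub_ge (m := m) (ℓ := ℓ) (R := R) (by omega) hRℓ (by omega)
  have hb : 0 ≤ offDiag m ℓ := Real.sqrt_nonneg _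
  have hR1 : (1 : ℝ) ≤ R := by exact_mod_cast hR
  have h4 : 1 / (R : ℝ) ≤ 1 := by rw [div_le_one (by linarith)]; exact hR1
  have h5 : (0 : ℝ) ≤ 1 / R * (R / ℓ) := by positivity
  refine le_trans ?_ (h2.trans h1)
  calc 2 * (1 - η) * offDiag m ℓ
      ≤ 2 * ((1 - 1 / (R : ℝ)) * (1 - R / ℓ)) * offDiag m ℓ := by
        gcongr
        linarith
    _ = 2 * (1 - 1 / (R : ℝ)) * ((1 - R / ℓ) * offDiag m ℓ) := by ring
    _ ≤ 2 * (1 - 1 / (R : ℝ)) * offDiag m (ℓ - R) := by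
        have : (0 : ℝ) ≤ 1 - 1 / R := by linarith
        gcongr

/-- The numerical estimate behind `measureProb_objective_lt_le`: the first square bounds
`‖f ψ‖ ^ 2` from above and the second one bounds the squared expectation from below. -/
lemma sq_sub_sq_le {β s lam : ℝ} (hs0 : 0 ≤ s) (hs : s ≤ 1 / 2) (hlam : 0 < lam)
    (hlam1 : lam ≤ 1) :
    (2 * β * (1 + 2 * (s / lam))) ^ 2 - (2 * (1 - s ^ 2) * β) ^ 2 ≤
      28 * β ^ 2 * (s / lam ^ 2) := by
  have hl2 : lam ^ 2 ≤ lam := by nlinarith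
  have h1 : s / lam ≤ s / lam ^ 2 := by gcongr
  have h2 : (s / lam) ^ 2 ≤ 1 / 2 * (s / lam ^ 2) := by
    have : (s / lam) ^ 2 = s * (s / lam ^ 2) := by rw [div_pow]; ring
    rw [this]
    gcongr
  have h3 : s ^ 2 ≤ 1 / 2 * (s / lam ^ 2) := by
    have h4 : s ≤ s / lam ^ 2 := le_div_self hs0 (by positivity) (hl2.trans hlam1)
    nlinarith
  have h5 : (1 + 2 * (s / lam)) ^ 2 - (1 - s ^ 2) ^ 2 ≤ 7 * (s / lam ^ 2) := by
    linear_combination 4 * h1 + 4 * h2 + 2 * h3 + sq_nonneg (s ^ 2)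
  calc (2 * β * (1 + 2 * (s / lam))) ^ 2 - (2 * (1 - s ^ 2) * β) ^ 2
      = 4 * β ^ 2 * ((1 + 2 * (s / lam)) ^ 2 - (1 - s ^ 2) ^ 2) := by ring
    _ ≤ 4 * β ^ 2 * (7 * (s / lam ^ 2)) := by gcongr
    _ = 28 * β ^ 2 * (s / lam ^ 2) := by ring

/-- The objective of an optimal DQI state is rarely below half of its typical value: the last
Krawtchouk coefficient of a near-maximizer is small, and it alone prevents the state from being
an approximate eigenvector of the objective. -/
lemma measureProb_objective_lt_le {ℓ R : ℕ} (hB : DualDistGT B ℓ) (hℓ : 2 * ℓ ≤ m) (hR : 0 < R)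
    (hRℓ : R ≤ ℓ) {ψ : StateVec n} (hψ : IsOptimalDQIState B v ℓ ψ) {s : ℝ} (hs0 : 0 ≤ s)
    (hs : s ≤ 1 / 2) (hη : 1 / (R : ℝ) + R / ℓ ≤ s ^ 2) {lam : ℝ} (hlam : 0 < lam)
    (hlam1 : lam ≤ 1) (hb : lam * m ≤ offDiag m ℓ)
    (hτ : (inner ℂ (kVec B v ℓ) (boundaryVec B v ℓ)).re ≤ offDiag m ℓ / 2) :
    measureProb ψ {x | objective B v x < offDiag m ℓ} ≤ 112 * s / lam ^ 2 := by
  have hc := isJacobiChain_kVec v hB hℓ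
  have hm' : (0 : ℝ) < m := by exact_mod_cast (by omega : 0 < m)
  have hbpos : 0 < offDiag m ℓ := lt_of_lt_of_le (by positivity) hb
  have hθ := le_expectedObjective v hB hℓ hR hRℓ hψ hη
  obtain ⟨P, hP, hPe⟩ := hψ.1.2
  obtain ⟨p, hp, hpe⟩ := exists_comb_eq_dqiVec v hB hℓ hP
  rw [← hPe] at hpe
  have hψ1 := hψ.1.1
  have hup := hc.re_inner_map_comb_le hp
  rw [← hpe, re_inner_objOp, hψ1] at hup
  have hs2 : s ^ 2 ≤ 1 / 4 := by nlinarith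
  have hgap : offDiag m ℓ / 2 ≤ expectedObjective B v ψ - offDiag m ℓ := by
    linear_combination hθ + 2 * mul_le_mul_of_nonneg_right hs2 hbpos.le
  have hcheb := measureProb_mul_sq_le B v hψ1 (a := offDiag m ℓ) (by linarith)
  have hM := hc.norm_map_comb_le hp
  rw [← hpe, hψ1] at hM
  have hW := norm_boundaryVec_le v hB (show ℓ ≤ m by omega)
  set β := offDiag m ℓ
  set θ := expectedObjective B v ψ
  set τ := (inner ℂ (kVec B v ℓ) (boundaryVec B v ℓ)).re
  have hpl : ‖p ℓ‖ ≤ 2 * s := by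
    refine le_of_sq_le_sq ?_ (by positivity)
    have h1 : ‖p ℓ‖ ^ 2 * τ ≤ ‖p ℓ‖ ^ 2 * (β / 2) := by gcongr
    have h2 : β * ‖p ℓ‖ ^ 2 ≤ β * (2 * s) ^ 2 := by nlinarith
    exact le_of_mul_le_mul_left h2 hbpos
  have hM' : ‖objOp B v ψ‖ ≤ 2 * β * (1 + 2 * (s / lam)) := by
    have h1 : ‖p ℓ‖ * ‖boundaryVec B v ℓ‖ ≤ 2 * s * (2 * m) := by gcongr
    have h2 : s * m ≤ s * (β / lam) := by
      have : (m : ℝ) ≤ β / lam := by rw [le_div_iff₀ hlam]; linarith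
      gcongr
    have h3 : s * (β / lam) = β * (s / lam) := by ring
    nlinarith
  have hvar : ‖objOp B v ψ‖ ^ 2 - θ ^ 2 ≤ 28 * β ^ 2 * (s / lam ^ 2) := by
    refine le_trans ?_ (sq_sub_sq_le hs0 hs hlam hlam1)
    have h1 : 0 ≤ 2 * (1 - s ^ 2) * β := mul_nonneg (by nlinarith) hbpos.le
    gcongr
  have hprob : 0 ≤ measureProb ψ {x | objective B v x < β} := sum_nonneg fun _ _ => by positivity
  have hgap' : (β / 2) ^ 2 ≤ (θ - β) ^ 2 := by gcongr
  have h8 : measureProb ψ {x | objective B v x < β} * (β / 2) ^ 2 ≤ 28 * β ^ 2 * (s / lam ^ 2) :=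
    (mul_le_mul_of_nonneg_left hgap' hprob).trans (hcheb.trans hvar)
  have h9 : β ^ 2 * measureProb ψ {x | objective B v x < β} ≤ β ^ 2 * (112 * s / lam ^ 2) := by
    have : 112 * s / lam ^ 2 = 112 * (s / lam ^ 2) := by ring
    rw [this]
    nlinarith
  exact le_of_mul_le_mul_left h9 (by positivity)

lemma choose_mul_pow_le_choose_add {ℓ r : ℕ} {ρ : ℝ} (hρ : 0 ≤ ρ) (hr : ℓ + r ≤ m)
    (h : ρ * (ℓ + r) ≤ m - (ℓ + r)) : (m.choose ℓ : ℝ) * ρ ^ r ≤ m.choose (ℓ + r) := by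
  induction r with
  | zero => simp
  | succ r ih =>
    push_cast at h
    have ih' := ih (by omega) (by nlinarith)
    have h1 := cast_choose_succ_mul (m := m) (k := ℓ + r) (by omega)
    push_cast at h1
    have hpos : (0 : ℝ) < ℓ + r + 1 := by positivity
    refine le_of_mul_le_mul_right ?_ hpos
    rw [show ℓ + (r + 1) = ℓ + r + 1 by ring, h1]
    calc (m.choose ℓ : ℝ) * ρ ^ (r + 1) * (ℓ + r + 1)
        = (m.choose ℓ * ρ ^ r) * (ρ * (ℓ + r + 1)) := by ring
      _ ≤ m.choose (ℓ + r) * (m - (ℓ + r)) := by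
          have h2 : ρ * (ℓ + r + 1) ≤ m - ((ℓ : ℝ) + r) := by linarith
          gcongr

/-- The sphere-packing bound that list decoding gives exceeds `m.choose ℓ` by the factor `ρ ^ r`,
so that small sets carry little probability. -/
lemma measureProb_mul_pow_le {ℓ r : ℕ} (hB : DualDistGT B ℓ) (hℓ : 2 * ℓ ≤ m) {ψ : StateVec n}
    (hψ : IsDQIState B v ℓ ψ) {N ρ : ℝ} (hN : ∀ s, (#(cosetWords B (ℓ + r) s) : ℝ) ≤ N)
    (hρ : 0 ≤ ρ) (hr : ℓ + r ≤ m) (h : ρ * (ℓ + r) ≤ m - (ℓ + r)) (T : Finset (Bits n)) :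
    measureProb ψ T * ρ ^ r ≤ #T * ((ℓ + 1) * N) := by
  have h1 : measureProb ψ T ≤ #T * ((ℓ + 1) * m.choose ℓ / 2 ^ n) := by
    rw [measureProb, ← nsmul_eq_mul, ← sum_const]
    exact sum_le_sum fun x _ => norm_sq_apply_le v hB hℓ hψ x
  have h2 := (choose_mul_pow_le_choose_add hρ hr h).trans (choose_le_of_card_cosetWords_le hN)
  calc measureProb ψ T * ρ ^ r ≤ #T * ((ℓ + 1) * m.choose ℓ / 2 ^ n) * ρ ^ r := by gcongr
    _ = #T * ((ℓ + 1) / 2 ^ n) * (m.choose ℓ * ρ ^ r) := by ring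
    _ ≤ #T * ((ℓ + 1) / 2 ^ n) * (N * 2 ^ n) := by gcongr
    _ = #T * ((ℓ + 1) * N) := by field_simp

lemma IsGenerator.le (hB : IsGenerator B) : n ≤ m := by
  have h := Fintype.card_le_of_injective _ hB
  simp only [Fintype.card_pi, ZMod.card, prod_const, card_univ, Fintype.card_fin] at h
  exact (Nat.pow_le_pow_iff_right (by norm_num)).mp h

lemma measureProb_filter_not {ψ : StateVec n} (hψ : ‖ψ‖ = 1) (p : Bits n → Prop)
    [DecidablePred p] : measureProb ψ {x | p x} + measureProb ψ {x | ¬ p x} = 1 := by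
  rw [measureProb, measureProb, sum_filter_add_sum_filter_not, ← EuclideanSpace.norm_sq_eq, hψ,
    one_pow]

end

/-! ### Asymptotics -/

section

variable {m n : ℕ} {B : Matrix (Fin m) (Fin n) (ZMod 2)} (v : Bits m)

/-- Stated through continuity in the exponent, so that the case `n = 0` needs no separate
treatment. -/
lemma exists_rpow_eq_of_mem_Icc {c₁ c₂ x : ℝ} (hc : c₁ ≤ c₂) (n : ℕ)
    (h₁ : (2 : ℝ) ^ (c₁ * (n : ℝ)) ≤ x) (h₂ : x ≤ (2 : ℝ) ^ (c₂ * (n : ℝ))) :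
    ∃ c : ℝ, c₁ ≤ c ∧ c ≤ c₂ ∧ x = (2 : ℝ) ^ (c * (n : ℝ)) := by
  have hcont : ContinuousOn (fun c : ℝ => (2 : ℝ) ^ (c * (n : ℝ))) (Set.Icc c₁ c₂) :=
    (Real.continuous_const_rpow two_ne_zero |>.comp (continuous_mul_const _)).continuousOn
  obtain ⟨c, hc, rfl⟩ := intermediate_value_Icc hc hcont ⟨h₁, h₂⟩
  exact ⟨c, hc.1, hc.2, rfl⟩

lemma floor_ge_half {a : ℝ} (ha : 2 ≤ a) : a / 2 ≤ (⌊a⌋₊ : ℝ) := by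
  have := Nat.lt_floor_add_one a
  linarith

/-- The list-decoding weight `ℓ + r` is about `(lam + δ) * m ≤ μ * m`, below `m / 2`, so consecutive
binomial coefficients up to it grow by the factor `(1 - μ) / μ > 1`. Half of the exponent gained is
spent on the size of `T`. -/
lemma measureProb_le_of_card_lt {ℓ : ℕ} (hB : DualDistGT B ℓ) (hℓ : 2 * ℓ ≤ m) (hn : n ≤ m)
    {ψ : StateVec n} (hψ : IsDQIState B v ℓ ψ) {lam μ δ c : ℝ} (hlam : 0 < lam) (hμ0 : 0 < μ)
    (hμ1 : μ < 1 / 2) (hδ : 0 < δ) (hδ1 : δ ≤ lam ^ 2 / 2) (hδμ : lam + δ ≤ μ)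
    (hc0 : 0 ≤ c) (hc : c ≤ δ / 4 * Real.logb 2 ((1 - μ) / μ)) (hℓm : (ℓ : ℝ) = lam * m)
    (hm : 0 < m) (hmδ : 2 ≤ δ * m) {T : Finset (Bits n)}
    (hT : (#T : ℝ) < (2 : ℝ) ^ (c * (n : ℝ))) :
    measureProb ψ T ≤ (lam * m + 1) * (2 / lam) * (((1 - μ) / μ) ^ (-(δ / 4))) ^ m := by
  have hm' : (0 : ℝ) < m := by exact_mod_cast hm
  set ρ := (1 - μ) / μ with hρ
  have hρ1 : 1 < ρ := by rw [hρ, one_lt_div hμ0]; linarith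
  have hρ0 : 0 < ρ := by linarith
  set r := ⌊δ * m⌋₊ with hr
  have hr1 : (r : ℝ) ≤ δ * m := Nat.floor_le (by positivity)
  have hr2 : δ / 2 * m ≤ r := by
    have := floor_ge_half hmδ
    linarith
  have hw : (ℓ : ℝ) + r ≤ μ * m := by
    have : (lam + δ) * m ≤ μ * m := by gcongr
    linarith
  have hN := fun s => card_cosetWords_le hB hlam hm hℓm
    (show (r : ℝ) ≤ lam ^ 2 * m / 2 by
      have : δ * m ≤ lam ^ 2 / 2 * m := by gcongr
      linarith) s
  have hρw : ρ * (ℓ + r) ≤ m - (ℓ + r) := by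
    have : ρ * (ℓ + r) ≤ ρ * (μ * m) := by gcongr
    have h2 : ρ * (μ * m) = (1 - μ) * m := by rw [hρ]; field_simp
    linarith
  have hlr : ℓ + r ≤ m := by
    have : (ℓ : ℝ) + r ≤ m := by nlinarith
    exact_mod_cast this
  have key := measureProb_mul_pow_le v hB hℓ hψ hN hρ0.le hlr hρw T
  have hT' : (#T : ℝ) ≤ ρ ^ (δ / 4 * m) := by
    refine hT.le.trans ?_
    have h1 : c * (n : ℝ) ≤ Real.logb 2 ρ * (δ / 4 * m) := by
      have h2 : (n : ℝ) ≤ m := by exact_mod_cast hn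
      calc c * (n : ℝ) ≤ c * m := by gcongr
        _ ≤ δ / 4 * Real.logb 2 ρ * m := by gcongr
        _ = Real.logb 2 ρ * (δ / 4 * m) := by ring
    calc (2 : ℝ) ^ (c * (n : ℝ)) ≤ 2 ^ (Real.logb 2 ρ * (δ / 4 * m)) :=
          Real.rpow_le_rpow_of_exponent_le one_le_two h1
      _ = ρ ^ (δ / 4 * m) := by
          rw [Real.rpow_mul zero_le_two, Real.rpow_logb two_pos (by norm_num) hρ0]
  have hpow : ρ ^ (δ / 4 * m) * ρ ^ (δ / 4 * m) ≤ ρ ^ r := by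
    rw [← Real.rpow_add hρ0, ← Real.rpow_natCast]
    exact Real.rpow_le_rpow_of_exponent_le hρ1.le (by linarith)
  have hpos : 0 < ρ ^ (δ / 4 * m) := Real.rpow_pos_of_pos hρ0 _
  have hprob : 0 ≤ measureProb ψ T := sum_nonneg fun _ _ => by positivity
  have hq : (ρ ^ (-(δ / 4))) ^ m = (ρ ^ (δ / 4 * m))⁻¹ := by
    rw [← Real.rpow_natCast, ← Real.rpow_mul hρ0.le, ← Real.rpow_neg hρ0.le]
    congr 1
    ring
  rw [hq, ← div_eq_mul_inv, le_div_iff₀ hpos]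
  refine le_of_mul_le_mul_right ?_ hpos
  calc measureProb ψ T * ρ ^ (δ / 4 * m) * ρ ^ (δ / 4 * m)
      = measureProb ψ T * (ρ ^ (δ / 4 * m) * ρ ^ (δ / 4 * m)) := by ring
    _ ≤ measureProb ψ T * ρ ^ r := by gcongr
    _ ≤ #T * ((ℓ + 1) * (2 / lam)) := key
    _ ≤ ρ ^ (δ / 4 * m) * ((ℓ + 1) * (2 / lam)) := by gcongr
    _ = (lam * m + 1) * (2 / lam) * ρ ^ (δ / 4 * m) := by rw [hℓm]; ring

lemma card_le_objective_le_rpow {ℓ : ℕ} (hB : DualDistGT B ℓ) (hℓ : 2 * ℓ ≤ m) (hn : n ≤ m)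
    (hm : 0 < m) {lam : ℝ} (hlam : 0 < lam) (hlam1 : lam ≤ 1) (hℓm : (ℓ : ℝ) = lam * m)
    (hmlam : 16 ≤ lam ^ 2 * m) :
    (#{x | lam * m ≤ objective B v x} : ℝ) ≤ (2 : ℝ) ^ ((1 - lam ^ 2 / 16) * (n : ℝ)) := by
  have hm' : (0 : ℝ) < m := by exact_mod_cast hm
  have hk1 : (⌊lam ^ 2 * m / 8⌋₊ : ℝ) ≤ lam ^ 2 * m / 8 := Nat.floor_le (by positivity)
  have hk2 := floor_ge_half (a := lam ^ 2 * m / 8) (by linarith)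
  set k := ⌊lam ^ 2 * m / 8⌋₊
  have hkℓ : k ≤ ℓ := by
    have h1 : lam ^ 2 * m ≤ lam * m := by
      have : lam ^ 2 ≤ lam := by nlinarith
      gcongr
    have : (k : ℝ) ≤ ℓ := by nlinarith
    exact_mod_cast this
  have h := card_le_objective_mul_two_pow_le v hB hℓ hm hkℓ hlam hk1
  rw [← le_div_iff₀ (by positivity), ← Real.rpow_natCast, ← Real.rpow_natCast,
    ← Real.rpow_sub two_pos] at h
  refine h.trans (Real.rpow_le_rpow_of_exponent_le one_le_two ?_)
  have h2 : lam ^ 2 * n ≤ lam ^ 2 * m := by gcongr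
  linarith

lemma le_offDiag {ℓ : ℕ} {lam : ℝ} (hlam : 0 < lam) (hlam1 : lam < 1 / 2)
    (hℓm : (ℓ : ℝ) = lam * m) (hℓ : ℓ ≤ m) : lam * m ≤ offDiag m ℓ := by
  refine le_of_sq_le_sq ?_ (Real.sqrt_nonneg _)
  rw [offDiag_sq hℓ, hℓm, sq]
  have : (0 : ℝ) ≤ m := Nat.cast_nonneg m
  refine mul_le_mul_of_nonneg_left ?_ (by positivity)
  nlinarith

/-- The corner entry of the Jacobi matrix is bounded, so eventually negligible. -/
lemma re_inner_kVec_boundaryVec_le {ℓ : ℕ} (hB : DualDistGT B ℓ) {lam : ℝ} (hlam : 0 < lam)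
    (hlam1 : lam < 1 / 2) (hm : 0 < m) (hℓm : (ℓ : ℝ) = lam * m) (h1 : 4 ≤ lam ^ 2 * m)
    (h2 : 2 ≤ (1 - 2 * lam) * m) (h3 : 8 ≤ lam ^ 2 * (1 - 2 * lam) * m) :
    (inner ℂ (kVec B v ℓ) (boundaryVec B v ℓ)).re ≤ offDiag m ℓ / 2 := by
  have hm' : (0 : ℝ) < m := by exact_mod_cast hm
  have hℓ : 2 * ℓ + 1 ≤ m := by
    have : 2 * (ℓ : ℝ) + 1 ≤ m := by linarith
    exact_mod_cast this
  have h := re_inner_kVec_boundaryVec_mul_le v hB hℓ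
    (card_cosetWords_le hB hlam hm hℓm (r := 2) (by push_cast; linarith))
  have hb := le_offDiag hlam hlam1 hℓm (by omega)
  refine le_trans ?_ (div_le_div_of_nonneg_right hb zero_le_two)
  by_contra! hcon
  have h4 : lam * m / 2 * ((1 - 2 * lam) * m / 2) < 2 / lam * m := by
    calc lam * m / 2 * ((1 - 2 * lam) * m / 2)
        < (inner ℂ (kVec B v ℓ) (boundaryVec B v ℓ)).re * ((1 - 2 * lam) * m / 2) := by
          gcongr
      _ ≤ (inner ℂ (kVec B v ℓ) (boundaryVec B v ℓ)).re * (m - 2 * ℓ - 1) := by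
          refine mul_le_mul_of_nonneg_left ?_ (le_trans (by positivity) hcon.le)
          linarith
      _ ≤ 2 / lam * (m - ℓ) := h
      _ ≤ 2 / lam * m := by
          gcongr
          linarith [(Nat.cast_nonneg ℓ : (0 : ℝ) ≤ ℓ)]
  rw [div_mul_eq_mul_div 2 lam, lt_div_iff₀ hlam] at h4
  linarith [mul_le_mul_of_nonneg_right h3 hm'.le]

end

end DQI

theorem mainTheorem12 (lam : ℝ) (hlam0 : 0 < lam) (hlam1 : lam < 1 / 2) :
    ∃ c₁ c₂ : ℝ, 0 < c₁ ∧ c₁ ≤ c₂ ∧ c₂ < 1 ∧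
      ∀ ε : ℝ, 0 < ε → ∃ M : ℕ, ∀ m n ℓ : ℕ, M ≤ m → (ℓ : ℝ) / (m : ℝ) = lam →
        ∀ (B : Matrix (Fin m) (Fin n) (ZMod 2)) (v : DQI.Bits m),
          DQI.IsGenerator B →
          (∃ D : DQI.Bits n → DQI.Bits m, DQI.IsDualDecoder B ℓ D) →
          ∀ ψ : DQI.StateVec n, DQI.IsOptimalDQIState B v ℓ ψ →
            (∃ S : Finset (DQI.Bits n), 1 - ε ≤ DQI.measureProb ψ S ∧
              ∃ c : ℝ, c₁ ≤ c ∧ c ≤ c₂ ∧ (S.card : ℝ) = (2 : ℝ) ^ (c * (n : ℝ))) ∧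
            (∀ T : Finset (DQI.Bits n), (T.card : ℝ) < (2 : ℝ) ^ (c₁ * (n : ℝ)) →
              DQI.measureProb ψ T ≤ ε) := by
  -- `μ` lies halfway between `lam` and `1 / 2`; the weight `(lam + δ) * m` stays below `μ * m` and
  -- within the range of the Johnson bound.
  set μ : ℝ := 1 / 4 + lam / 2 with hμ
  set δ : ℝ := min (lam ^ 2 / 2) (1 / 4 - lam / 2) with hδ
  set ρ : ℝ := (1 - μ) / μ with hρ
  have hδ0 : 0 < δ := lt_min (by positivity) (by linarith)
  have hδμ : lam + δ ≤ μ := by linarith [min_le_right (lam ^ 2 / 2) (1 / 4 - lam / 2)]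
  have hμ0 : 0 < μ := by positivity
  have hμ1 : μ < 1 / 2 := by linarith
  have hρ1 : 1 < ρ := by rw [hρ, one_lt_div hμ0]; linarith
  have hlog : 0 < δ / 4 * Real.logb 2 ρ := mul_pos (by positivity) (Real.logb_pos one_lt_two hρ1)
  have hc₂ : 0 < 1 - lam ^ 2 / 16 := by nlinarith
  have hc₁ : 0 < min (δ / 4 * Real.logb 2 ρ) (1 - lam ^ 2 / 16) := lt_min hlog hc₂
  refine ⟨min (δ / 4 * Real.logb 2 ρ) (1 - lam ^ 2 / 16), 1 - lam ^ 2 / 16, hc₁, min_le_right _ _,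
    by linarith [sq_pos_of_pos hlam0], fun ε hε => ?_⟩
  -- A failure probability below `1 / 2` lets the second claim bound the size of `S` from below.
  set ε' : ℝ := min ε (1 / 4) with hε'
  have hε'0 : 0 < ε' := lt_min hε (by norm_num)
  have hε'1 : ε' ≤ 1 / 4 := min_le_right _ _
  have hε'ε : ε' ≤ ε := min_le_left _ _
  -- The relative deficit of the trial state is at most `s ^ 2`, and the probability of a low
  -- objective at most `112 * s / lam ^ 2`.
  set s : ℝ := min (1 / 2) (ε' * lam ^ 2 / 112) with hs
  have hs0 : 0 < s := lt_min (by norm_num) (by positivity)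
  have hsε : 112 * s / lam ^ 2 ≤ ε' := by
    rw [div_le_iff₀ (by positivity)]
    linarith [min_le_right (1 / 2) (ε' * lam ^ 2 / 112)]
  set R : ℕ := ⌈2 / s ^ 2⌉₊ with hR
  have hR0 : 0 < R := Nat.ceil_pos.mpr (by positivity)
  have hRs : 2 / s ^ 2 ≤ R := Nat.le_ceil _
  have hq : Filter.Tendsto
      (fun m : ℕ => (lam * m + 1) * (2 / lam) * (ρ ^ (-(δ / 4))) ^ m) Filter.atTop (nhds 0) := by
    have hq0 : 0 ≤ ρ ^ (-(δ / 4)) := Real.rpow_nonneg (by linarith) _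
    have hq1 : ρ ^ (-(δ / 4)) < 1 := Real.rpow_lt_one_of_one_lt_of_neg hρ1 (by linarith)
    have h1 := (tendsto_self_mul_const_pow_of_lt_one hq0 hq1).const_mul 2
    have h2 := (tendsto_pow_atTop_nhds_zero_of_lt_one hq0 hq1).const_mul (2 / lam)
    have h3 := h1.add h2
    rw [mul_zero, mul_zero, add_zero] at h3
    refine h3.congr fun m => ?_
    field_simp
  have hlarge : ∀ a b : ℝ, 0 < a → ∀ᶠ m : ℕ in Filter.atTop, b ≤ a * m := fun a b ha =>
    (tendsto_natCast_atTop_atTop.const_mul_atTop ha).eventually_ge_atTop b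
  have hev := (hq.eventually_le_const hε'0).and <| (hlarge δ 2 hδ0).and <|
    (hlarge (lam ^ 2) 16 (by positivity)).and <| (hlarge (1 - 2 * lam) 2 (by linarith)).and <|
    (hlarge (lam ^ 2 * (1 - 2 * lam)) 8 (mul_pos (by positivity) (by linarith))).and <|
    (hlarge lam (2 * R / s ^ 2) hlam0).and (Filter.eventually_gt_atTop 0)
  obtain ⟨M, hM⟩ := Filter.eventually_atTop.mp hev
  refine ⟨M, fun m n ℓ hMm hℓ B v hgen ⟨D, hD⟩ ψ hψ => ?_⟩
  obtain ⟨hdecay, hmδ, hm16, hm2, hm8, hmR, hm⟩ := hM m hMm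
  have hm' : (0 : ℝ) < m := by exact_mod_cast hm
  have hℓm : (ℓ : ℝ) = lam * m := (div_eq_iff hm'.ne').mp hℓ
  have hB := hD.dualDistGT
  have h2ℓ : 2 * ℓ ≤ m := by
    have : 2 * (ℓ : ℝ) ≤ m := by nlinarith
    exact_mod_cast this
  have hn := hgen.le
  have hsmall : ∀ T : Finset (DQI.Bits n),
      (T.card : ℝ) < (2 : ℝ) ^ (min (δ / 4 * Real.logb 2 ρ) (1 - lam ^ 2 / 16) * (n : ℝ)) →
      DQI.measureProb ψ T ≤ ε' := fun T hT =>
    (DQI.measureProb_le_of_card_lt v hB h2ℓ hn hψ.1 hlam0 hμ0 hμ1 hδ0 (min_le_left _ _) hδμ hc₁.le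
      (min_le_left _ _) hℓm hm hmδ hT).trans hdecay
  refine ⟨?_, fun T hT => (hsmall T hT).trans hε'ε⟩
  have hℓ0 : (0 : ℝ) < ℓ := by rw [hℓm]; positivity
  have hRℓ' : (R : ℝ) / ℓ ≤ s ^ 2 / 2 := by
    rw [← hℓm, div_le_iff₀ (by positivity)] at hmR
    rw [div_le_iff₀ hℓ0]
    linarith
  have hs1 : s ≤ 1 / 2 := min_le_left _ _
  have hRℓ : R ≤ ℓ := by
    have : (R : ℝ) ≤ ℓ := by
      rw [← div_le_one hℓ0]
      nlinarith
    exact_mod_cast this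
  have hη : 1 / (R : ℝ) + R / ℓ ≤ s ^ 2 := by
    have : 1 / (R : ℝ) ≤ s ^ 2 / 2 := by
      rw [div_le_iff₀ (by positivity)] at hRs
      rw [div_le_iff₀ (by exact_mod_cast hR0)]
      linarith
    linarith
  have hb := DQI.le_offDiag hlam0 hlam1 hℓm (by omega)
  have hτ := DQI.re_inner_kVec_boundaryVec_le v hB hlam0 hlam1 hm hℓm (by linarith) hm2 hm8
  have hlow := DQI.measureProb_objective_lt_le v hB h2ℓ hR0 hRℓ hψ hs0.le hs1 hη hlam0
    (by linarith) hb hτ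
  have hcompl := DQI.measureProb_filter_not hψ.1.1 fun x => DQI.objective B v x < DQI.offDiag m ℓ
  set S : Finset (DQI.Bits n) := {x | ¬ DQI.objective B v x < DQI.offDiag m ℓ}
  refine ⟨S, by linarith, DQI.exists_rpow_eq_of_mem_Icc (min_le_right _ _) n ?_ ?_⟩
  · by_contra! hcard
    linarith [hsmall S hcard]
  · refine le_trans ?_ (DQI.card_le_objective_le_rpow v hB h2ℓ hn hm hlam0 (by linarith) hℓm hm16)
    have hsub : S ⊆ Finset.univ.filter fun x => lam * m ≤ DQI.objective B v x := fun x hx => by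
      simp only [S, Finset.mem_filter, Finset.mem_univ, true_and, not_lt] at hx ⊢
      exact hb.trans hx
    exact_mod_cast Finset.card_le_card hsub
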